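/- There is a constant $C$ such that every binary tree $T$ with $n\ge 1$ vertices has a planar straight-line order-preserving drawing of area at most $n\,2^{C\log^* n}$. Here a binary tree is a rooted tree in which every vertex has at most one left child and at most one right child. A planar straight-line drawing of $T$ with width $W$ and height $H$ maps the vertices injectively to points of the integer grid $\{1,\dots,W\}\times\{1,\dots,H\}$ and each edge to the straight segment between its endpoints, so that no edge passes through a vertex other than its endpoints and two distinct edges meet only at a common endpoint; its area is $WH$. The drawing is order-preserving if around every vertex $v$ that has a parent and two children, the parent, the left child and the right child of $v$ appear in counterclockwise order. The iterated logarithm $\log^* n$ is the least $k\ge 0$ such that applying $\log_2$ to $n$ successively $k$ times gives a value at most $1$. -/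

import Mathlib

/-! ### Binary trees and their vertices

A binary tree is a term of `BinaryTree Unit`: either empty (`nil`) or a vertex with a left and a
right subtree, each possibly empty. Its size is `BinaryTree.numNodes`, the number of `node`s. -/

namespace BinaryTreeDrawing

/-- A vertex is named by the path from the root to it: `[]` is the root, `false` is a step to the
left child and `true` a step to the right child. `IsVertex T v` says that `v` names a vertex
of `T`. -/
def IsVertex : BinaryTree Unit → List Bool → Prop
  | .nil, _ => False
  | .node _ _ _, [] => True
  | .node _ l _, false :: v => IsVertex l v
  | .node _ _ r, true :: v => IsVertex r v

/-- The left child (`b = false`) or right child (`b = true`) of `v`, if it exists in the tree. -/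
def child (v : List Bool) (b : Bool) : List Bool := v ++ [b]

/-- `T` has an edge from the vertex `u` to its child `v`. -/
def IsEdge (T : BinaryTree Unit) (u v : List Bool) : Prop :=
  IsVertex T v ∧ ∃ b : Bool, v = child u b

/-! ### Drawings -/

/-- A grid point as a point of the plane. -/
def toPlane (p : ℤ × ℤ) : ℝ × ℝ := ((p.1 : ℝ), (p.2 : ℝ))

/-- The closed straight-line segment that represents an edge between `u` and `v`. -/
def edgeSegment (pos : List Bool → ℤ × ℤ) (u v : List Bool) : Set (ℝ × ℝ) :=
  segment ℝ (toPlane (pos u)) (toPlane (pos v))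

/-- `pos` is a planar straight-line drawing of `T` on the grid `{1, …, W} × {1, …, H}`.
Only the values of `pos` at vertices of `T` matter. -/
structure IsPlanarDrawing (T : BinaryTree Unit) (W H : ℕ) (pos : List Bool → ℤ × ℤ) : Prop where
  mem_grid : ∀ v, IsVertex T v →
    pos v ∈ Set.Icc (1 : ℤ) (W : ℤ) ×ˢ Set.Icc (1 : ℤ) (H : ℤ)
  injective : ∀ u v, IsVertex T u → IsVertex T v → pos u = pos v → u = v
  /-- No edge passes through a vertex other than its endpoints. -/
  vertex_edge : ∀ w u v, IsVertex T w → IsEdge T u v →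
    toPlane (pos w) ∈ edgeSegment pos u v → w = u ∨ w = v
  /-- Two different edges meet only at a common endpoint. -/
  edge_edge : ∀ u v u' v', IsEdge T u v → IsEdge T u' v' → (u, v) ≠ (u', v') →
    ∀ x ∈ edgeSegment pos u v ∩ edgeSegment pos u' v',
      ∃ w, (w = u ∨ w = v) ∧ (w = u' ∨ w = v') ∧ x = toPlane (pos w)

/-- The points `a`, `b`, `c` appear in this counterclockwise cyclic order around `o`:
rotating counterclockwise from the direction of `a`, one meets the direction of `b` strictly before
that of `c`, and that of `c` before completing a full turn. -/
def IsCounterclockwise (o a b c : ℝ × ℝ) : Prop :=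
  ∃ α β γ r s t : ℝ, α < β ∧ β < γ ∧ γ < α + 2 * Real.pi ∧ 0 < r ∧ 0 < s ∧ 0 < t ∧
    a = o + r • (Real.cos α, Real.sin α) ∧
    b = o + s • (Real.cos β, Real.sin β) ∧
    c = o + t • (Real.cos γ, Real.sin γ)

/-- Around every vertex that has a parent `p`, a left child and a right child, these three appear
in counterclockwise order. (A cyclic order of at most two neighbours is no constraint.) -/
def IsOrderPreserving (T : BinaryTree Unit) (pos : List Bool → ℤ × ℤ) : Prop :=
  ∀ p v, IsEdge T p v → IsVertex T (child v false) → IsVertex T (child v true) →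
    IsCounterclockwise (toPlane (pos v)) (toPlane (pos p))
      (toPlane (pos (child v false))) (toPlane (pos (child v true)))

/-! ### The iterated logarithm -/

/-- `log* x`: the least number of applications of the binary logarithm that takes `x` to a value
at most `1`. -/
noncomputable def logStar (x : ℝ) : ℕ := sInf {k : ℕ | (Real.logb 2)^[k] x ≤ 1}

/-- The set in the definition of `logStar` is never empty. -/
theorem logStar_set_nonempty (x : ℝ) : {k : ℕ | (Real.logb 2)^[k] x ≤ 1}.Nonempty := by
  have key : ∀ (m : ℕ) (y : ℝ), y ≤ (m : ℝ) + 1 → ∃ k : ℕ, (Real.logb 2)^[k] y ≤ 1 := by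
    intro m
    induction m with
    | zero => intro y hy; exact ⟨0, by simpa using hy⟩
    | succ m ih =>
      intro y hy
      by_cases h1 : y ≤ 1
      · exact ⟨0, by simpa using h1⟩
      · have hy0 : 0 < y := by linarith
        have h2 : (m + 2 : ℕ) ≤ 2 ^ (m + 1) := Nat.lt_two_pow_self (n := m + 1)
        have h3 : y ≤ (2 : ℝ) ^ ((m : ℝ) + 1) := by
          have h4 : ((m + 2 : ℕ) : ℝ) ≤ ((2 ^ (m + 1) : ℕ) : ℝ) := by exact_mod_cast h2
          have h5 : (2 : ℝ) ^ ((m : ℝ) + 1) = ((2 ^ (m + 1) : ℕ) : ℝ) := by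
            rw [show ((m : ℝ) + 1) = ((m + 1 : ℕ) : ℝ) by push_cast; ring, Real.rpow_natCast]
            push_cast; ring
          rw [h5]
          push_cast at h4 hy ⊢
          linarith
        obtain ⟨k, hk⟩ := ih (Real.logb 2 y)
          ((Real.logb_le_iff_le_rpow (by norm_num) hy0).2 h3)
        exact ⟨k + 1, by simpa [Function.iterate_succ_apply] using hk⟩
  obtain ⟨m, hm⟩ := exists_nat_ge x
  exact key m x (by linarith)

end BinaryTreeDrawing

namespace BinaryTreeDrawing

/-! ### Labelled trees, mirroring, and spines -/

/-- Relabel a tree by `f`, exchanging left and right everywhere if `κ` is true. -/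
def relabel {α β : Type} (κ : Bool) (f : α → β) : BinaryTree α → BinaryTree β
  | .nil => .nil
  | .node v l r =>
    bif κ then .node (f v) (relabel κ f r) (relabel κ f l)
    else .node (f v) (relabel κ f l) (relabel κ f r)

/-- The label of the root. -/
def root? {α : Type} : BinaryTree α → Option α
  | .nil => none
  | .node v _ _ => some v

/-- A tree with one vertex. -/
def leaf {α : Type} (v : α) : BinaryTree α := .node v .nil .nil

/-- The tree with root `v` whose subtrees are `t` and `s`, with `t` on the right if `b` is true. -/
def join {α : Type} (b : Bool) (v : α) (t s : BinaryTree α) : BinaryTree α :=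
  bif b then .node v s t else .node v t s

/-- A vertex of a path together with the subtree hanging off the path at it; the Boolean tells
whether that subtree is the right one. -/
abbrev Frame (α : Type) := Bool × α × BinaryTree α

/-- The tree with the spine `ds` and the subtree `e` below its last vertex. -/
def plug {α : Type} : List (Frame α) → BinaryTree α → BinaryTree α
  | [], e => e
  | f :: ds, e => join f.1 f.2.1 f.2.2 (plug ds e)

/-- Relabel and possibly mirror a frame. -/
def relabelF {α β : Type} (κ : Bool) (f : α → β) (x : Frame α) : Frame β :=
  (xor κ x.1, f x.2.1, relabel κ f x.2.2)

/-- The last vertex of the spine `ds`, or `p` if the spine is empty. -/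
def lastPos {α : Type} : α → List (Frame α) → α
  | p, [] => p
  | _, f :: ds => lastPos f.2.1 ds

section
variable {α β γ : Type}

@[simp] theorem relabel_nil (κ : Bool) (f : α → β) : relabel κ f .nil = .nil := rfl

@[simp] theorem root?_nil : root? (.nil : BinaryTree α) = none := rfl

@[simp] theorem root?_node (v : α) (l r : BinaryTree α) : root? (.node v l r) = some v := rfl

@[simp] theorem root?_leaf (v : α) : root? (leaf v) = some v := rfl

@[simp] theorem root?_join (b : Bool) (v : α) (t s : BinaryTree α) :
    root? (join b v t s) = some v := by cases b <;> rfl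

@[simp] theorem plug_nil (e : BinaryTree α) : plug [] e = e := rfl

@[simp] theorem plug_cons (f : Frame α) (ds : List (Frame α)) (e : BinaryTree α) :
    plug (f :: ds) e = join f.1 f.2.1 f.2.2 (plug ds e) := rfl

theorem plug_append (ds ds' : List (Frame α)) (e : BinaryTree α) :
    plug (ds ++ ds') e = plug ds (plug ds' e) := by
  induction ds with
  | nil => rfl
  | cons f ds ih => simp [ih]

@[simp] theorem lastPos_nil (p : α) : lastPos p [] = p := rfl

@[simp] theorem lastPos_cons (p : α) (f : Frame α) (ds : List (Frame α)) :
    lastPos p (f :: ds) = lastPos f.2.1 ds := rfl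

theorem lastPos_append (p : α) (ds ds' : List (Frame α)) :
    lastPos p (ds ++ ds') = lastPos (lastPos p ds) ds' := by
  induction ds generalizing p with
  | nil => rfl
  | cons f ds ih => simp [ih]

theorem lastPos_of_ne {ds : List (Frame α)} (h : ds ≠ []) (p p' : α) :
    lastPos p ds = lastPos p' ds := by
  cases ds with
  | nil => exact absurd rfl h
  | cons f ds => rfl

theorem lastPos_map (κ : Bool) (f : α → β) (p : α) (ds : List (Frame α)) :
    lastPos (f p) (ds.map (relabelF κ f)) = f (lastPos p ds) := by
  induction ds generalizing p with
  | nil => rfl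
  | cons g ds ih => simpa [relabelF] using ih g.2.1

theorem relabel_join (κ b : Bool) (f : α → β) (v : α) (t s : BinaryTree α) :
    relabel κ f (join b v t s) = join (xor κ b) (f v) (relabel κ f t) (relabel κ f s) := by
  cases κ <;> cases b <;> rfl

@[simp] theorem relabel_leaf (κ : Bool) (f : α → β) (v : α) :
    relabel κ f (leaf v) = leaf (f v) := by cases κ <;> rfl

theorem relabel_plug (κ : Bool) (f : α → β) (ds : List (Frame α)) (e : BinaryTree α) :
    relabel κ f (plug ds e) = plug (ds.map (relabelF κ f)) (relabel κ f e) := by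
  induction ds with
  | nil => rfl
  | cons g ds ih => simp [relabel_join, ih, relabelF]

theorem root?_relabel (κ : Bool) (f : α → β) (t : BinaryTree α) :
    root? (relabel κ f t) = (root? t).map f := by
  cases t <;> cases κ <;> rfl

theorem relabel_relabel (κ κ' : Bool) (g : β → γ) (f : α → β) (t : BinaryTree α) :
    relabel κ g (relabel κ' f t) = relabel (xor κ κ') (g ∘ f) t := by
  induction t with
  | nil => rfl
  | node v l r hl hr => cases κ <;> cases κ' <;> simp_all [relabel]

theorem relabelF_relabelF (κ κ' : Bool) (g : β → γ) (f : α → β) (x : Frame α) :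
    relabelF κ g (relabelF κ' f x) = relabelF (xor κ κ') (g ∘ f) x := by
  simp [relabelF, relabel_relabel]

theorem relabel_false_id (t : BinaryTree α) : relabel false id t = t := by
  induction t with
  | nil => rfl
  | node v l r hl hr => simp_all [relabel]

theorem relabelF_false_id (x : Frame α) : relabelF false id x = x := by
  simp [relabelF, relabel_false_id]

end

/-- The underlying tree of a labelled tree. -/
def shape {α : Type} (t : BinaryTree α) : BinaryTree Unit := relabel false (fun _ => ()) t

/-- The underlying frame of a labelled frame. -/
def shapeF {α : Type} (x : Frame α) : Frame Unit := relabelF false (fun _ => ()) x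

/-- The mirror image of a tree. -/
def mirror (t : BinaryTree Unit) : BinaryTree Unit := relabel true id t

/-- The mirror image of a frame. -/
def mirrorF (x : Frame Unit) : Frame Unit := relabelF true id x

@[simp] theorem mirror_mirror (t : BinaryTree Unit) : mirror (mirror t) = t := by
  simp [mirror, relabel_relabel, relabel_false_id]

@[simp] theorem mirrorF_mirrorF (x : Frame Unit) : mirrorF (mirrorF x) = x := by
  simp [mirrorF, relabelF_relabelF, relabelF_false_id]

@[simp] theorem map_mirrorF_map_mirrorF (s : List (Frame Unit)) :
    (s.map mirrorF).map mirrorF = s := by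
  simp [Function.comp_def]

theorem shape_relabel {α β : Type} (f : α → β) (κ : Bool) (t : BinaryTree α) :
    shape (relabel κ f t) = bif κ then mirror (shape t) else shape t := by
  cases κ <;> simp [shape, mirror, relabel_relabel, Function.comp_def]

theorem shapeF_relabelF {α β : Type} (f : α → β) (κ : Bool) (x : Frame α) :
    shapeF (relabelF κ f x) = bif κ then mirrorF (shapeF x) else shapeF x := by
  cases κ <;> simp [shapeF, mirrorF, relabelF_relabelF, Function.comp_def]

theorem map_shapeF_map_relabelF {α β : Type} (f : α → β) (κ : Bool) (ds : List (Frame α)) :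
    (ds.map (relabelF κ f)).map shapeF =
      bif κ then (ds.map shapeF).map mirrorF else ds.map shapeF := by
  cases κ <;> simp [shapeF_relabelF, Function.comp_def]

theorem shape_plug {α : Type} (ds : List (Frame α)) (e : BinaryTree α) :
    shape (plug ds e) = plug (ds.map shapeF) (shape e) := by
  exact relabel_plug false (fun _ : α => ()) ds e

/-! ### Segments and the set covered by a drawing -/

/-- The segment between two grid points. -/
def seg (p q : ℤ × ℤ) : Set (ℝ × ℝ) := segment ℝ (toPlane p) (toPlane q)

theorem mem_seg {p q : ℤ × ℤ} {a : ℝ × ℝ} : a ∈ seg p q ↔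
    ∃ t : ℝ, 0 ≤ t ∧ t ≤ 1 ∧ a.1 = p.1 + t * (q.1 - p.1) ∧ a.2 = p.2 + t * (q.2 - p.2) := by
  rw [seg, segment_eq_image']
  constructor
  · rintro ⟨t, ⟨h0, h1⟩, rfl⟩
    exact ⟨t, h0, h1, by simp [toPlane], by simp [toPlane]⟩
  · rintro ⟨t, h0, h1, h2, h3⟩
    exact ⟨t, ⟨h0, h1⟩, by ext <;> simp [toPlane, h2, h3]⟩

theorem left_mem_seg (p q : ℤ × ℤ) : toPlane p ∈ seg p q := left_mem_segment _ _ _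

theorem right_mem_seg (p q : ℤ × ℤ) : toPlane q ∈ seg p q := right_mem_segment _ _ _

theorem toPlane_injective : Function.Injective toPlane := by
  rintro ⟨a, b⟩ ⟨c, d⟩ h
  simpa [toPlane] using h

mutual
/-- The points covered by the drawing `d`. -/
def body : BinaryTree (ℤ × ℤ) → Set (ℝ × ℝ)
  | .nil => ∅
  | .node v l r => {toPlane v} ∪ (stem v l ∪ stem v r)

/-- The points covered by the drawing `d` and the edge from `p` to its root. -/
def stem (p : ℤ × ℤ) : BinaryTree (ℤ × ℤ) → Set (ℝ × ℝ)
  | .nil => ∅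
  | .node v l r => seg p v ∪ ({toPlane v} ∪ (stem v l ∪ stem v r))
end

/-- The orientation determinant of `a`, `b` as seen from `o`. -/
def cr (o a b : ℤ × ℤ) : ℤ := (a.1 - o.1) * (b.2 - o.2) - (a.2 - o.2) * (b.1 - o.1)

/-- The points `a`, `b`, `c` are in counterclockwise order around `o`. -/
def Ccw (o a b c : ℤ × ℤ) : Prop :=
  (0 < cr o a b ∧ 0 < cr o b c) ∨ (0 < cr o b c ∧ 0 < cr o c a) ∨ (0 < cr o c a ∧ 0 < cr o a b)

/-- The order condition at a vertex `v` with parent `p` and subtrees `l` and `r`. -/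
def OrdAt (p v : ℤ × ℤ) (l r : BinaryTree (ℤ × ℤ)) : Prop :=
  ∀ a ∈ root? l, ∀ c ∈ root? r, Ccw v p a c

/-- The labelled tree `d` is a planar order-preserving drawing, even if the point `p` is attached
to its root as a parent. -/
def Good (p : ℤ × ℤ) : BinaryTree (ℤ × ℤ) → Prop
  | .nil => True
  | .node v l r => p ≠ v ∧ (∀ a ∈ seg p v, a ∈ stem v l ∪ stem v r → a = toPlane v) ∧
      (∀ a ∈ stem v l, a ∈ stem v r → a = toPlane v) ∧ OrdAt p v l r ∧ Good v l ∧ Good v r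

@[simp] theorem body_nil : body .nil = ∅ := by simp [body]

@[simp] theorem stem_nil (p : ℤ × ℤ) : stem p .nil = ∅ := by simp [stem]

theorem body_node (v : ℤ × ℤ) (l r : BinaryTree (ℤ × ℤ)) :
    body (.node v l r) = {toPlane v} ∪ (stem v l ∪ stem v r) := by simp [body]

theorem stem_node (p v : ℤ × ℤ) (l r : BinaryTree (ℤ × ℤ)) :
    stem p (.node v l r) = seg p v ∪ body (.node v l r) := by simp [body, stem]

theorem body_join (b : Bool) (v : ℤ × ℤ) (t s : BinaryTree (ℤ × ℤ)) :
    body (join b v t s) = {toPlane v} ∪ (stem v t ∪ stem v s) := by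
  cases b <;> simp [join, body_node, Set.union_comm]

theorem stem_join (b : Bool) (p v : ℤ × ℤ) (t s : BinaryTree (ℤ × ℤ)) :
    stem p (join b v t s) = seg p v ∪ body (join b v t s) := by
  cases b <;> simp [join, stem_node]

theorem body_subset_stem (p : ℤ × ℤ) (d : BinaryTree (ℤ × ℤ)) : body d ⊆ stem p d := by
  cases d with
  | nil => simp
  | node v l r => rw [stem_node]; exact Set.subset_union_right

theorem mem_stem {p : ℤ × ℤ} {d : BinaryTree (ℤ × ℤ)} {a : ℝ × ℝ} :
    a ∈ stem p d ↔ (∃ v ∈ root? d, a ∈ seg p v) ∨ a ∈ body d := by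
  cases d with
  | nil => simp
  | node v l r => rw [stem_node]; simp

theorem root_mem_body {d : BinaryTree (ℤ × ℤ)} {v : ℤ × ℤ} (h : v ∈ root? d) :
    toPlane v ∈ body d := by
  cases d with
  | nil => simp at h
  | node w l r => simp at h; subst h; simp [body_node]

/-- `OrdAt` with the subtrees given as in `join`. -/
def OrdSide (b : Bool) (p v : ℤ × ℤ) (t s : BinaryTree (ℤ × ℤ)) : Prop :=
  ∀ a ∈ root? t, ∀ c ∈ root? s, bif b then Ccw v p c a else Ccw v p a c

theorem good_join {b : Bool} {p v : ℤ × ℤ} {t s : BinaryTree (ℤ × ℤ)} :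
    Good p (join b v t s) ↔ p ≠ v ∧ (∀ a ∈ seg p v, a ∈ stem v t ∪ stem v s → a = toPlane v) ∧
      (∀ a ∈ stem v t, a ∈ stem v s → a = toPlane v) ∧ OrdSide b p v t s ∧
      Good v t ∧ Good v s := by
  cases b
  · rfl
  · simp only [join, cond_true, Good, OrdAt, OrdSide, Set.union_comm (stem v t)]
    constructor
    · rintro ⟨h1, h2, h3, h4, h5, h6⟩
      exact ⟨h1, h2, fun a ha hb => h3 a hb ha, fun a ha c hc => h4 c hc a ha, h6, h5⟩
    · rintro ⟨h1, h2, h3, h4, h5, h6⟩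
      exact ⟨h1, h2, fun a ha hb => h3 a hb ha, fun a ha c hc => h4 c hc a ha, h6, h5⟩

theorem good_leaf {p v : ℤ × ℤ} : Good p (leaf v) ↔ p ≠ v := by
  simp [leaf, Good, OrdAt]

@[simp] theorem body_leaf (v : ℤ × ℤ) : body (leaf v) = {toPlane v} := by
  simp [leaf, body_node]

/-! ### Filling the hole of a spine -/

theorem stem_plug_subset (p z : ℤ × ℤ) (ds : List (Frame (ℤ × ℤ))) (d : BinaryTree (ℤ × ℤ))
    (h : root? d = some z) : stem p (plug ds d) ⊆ stem p (plug ds (leaf z)) ∪ body d := by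
  induction ds generalizing p with
  | nil =>
    intro a ha
    rcases mem_stem.1 ha with ⟨v, hv, ha⟩ | ha
    · rw [plug_nil, h] at hv
      simp at hv; subst hv
      exact Or.inl (mem_stem.2 (Or.inl ⟨z, by simp, ha⟩))
    · exact Or.inr ha
  | cons f ds ih =>
    intro a ha
    simp only [plug_cons, stem_join, body_join] at ha ⊢
    have := @ih f.2.1 a
    simp only [Set.mem_union] at ha this ⊢
    tauto

theorem stem_plug_nil_subset (p : ℤ × ℤ) (ds : List (Frame (ℤ × ℤ))) (d : BinaryTree (ℤ × ℤ)) :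
    stem p (plug ds .nil) ⊆ stem p (plug ds d) := by
  induction ds generalizing p with
  | nil => simp
  | cons f ds ih =>
    intro a ha
    simp only [plug_cons, stem_join, body_join] at ha ⊢
    have := @ih f.2.1 a
    simp only [Set.mem_union] at ha this ⊢
    tauto

theorem root?_plug_congr (ds : List (Frame (ℤ × ℤ))) {d d' : BinaryTree (ℤ × ℤ)}
    (h : root? d = root? d') : root? (plug ds d) = root? (plug ds d') := by
  cases ds <;> simp [h]

/-- The basis of all gluing. Order conditions and the edge into the hole depend only on the root of
what fills it, so a spine is checked once with a single vertex at `z`. The actual continuation only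
has to avoid the spine without its outgoing edge; its contact with that edge is covered by `Good
(lastPos p ds) d`. -/
theorem good_plug {p z : ℤ × ℤ} {ds : List (Frame (ℤ × ℤ))} {d : BinaryTree (ℤ × ℤ)}
    (h : Good p (plug ds (leaf z))) (hz : root? d = some z) (hd : Good (lastPos p ds) d)
    (hdis : ∀ a ∈ stem p (plug ds .nil), a ∉ body d) :
    Good p (plug ds d) := by
  induction ds generalizing p with
  | nil => exact hd
  | cons f ds ih =>
    simp only [plug_cons, stem_join, body_join, Set.mem_union] at h hdis ⊢
    rw [good_join] at h ⊢
    obtain ⟨h1, h2, h3, h4, h5, h6⟩ := h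
    have hsub := stem_plug_subset f.2.1 z ds d hz
    refine ⟨h1, fun a ha hb => ?_, fun a ha hb => ?_, ?_, h5,
      ih h6 hd fun a ha => hdis a (Or.inr (Or.inr (Or.inr ha)))⟩
    · rcases hb with hb | hb
      · exact h2 a ha (Or.inl hb)
      · rcases hsub hb with hb | hb
        · exact h2 a ha (Or.inr hb)
        · exact absurd hb (hdis a (Or.inl ha))
    · rcases hsub hb with hb | hb
      · exact h3 a ha hb
      · exact absurd hb (hdis a (Or.inr (Or.inr (Or.inl ha))))
    · intro a ha c hc
      exact h4 a ha c (by rwa [root?_plug_congr ds (d' := d) (by simpa using hz.symm)])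

theorem good_plug_nil {p z : ℤ × ℤ} {ds : List (Frame (ℤ × ℤ))}
    (h : Good p (plug ds (leaf z))) : Good p (plug ds .nil) := by
  induction ds generalizing p with
  | nil => trivial
  | cons f ds ih =>
    simp only [plug_cons] at h ⊢
    rw [good_join] at h ⊢
    obtain ⟨h1, h2, h3, h4, h5, h6⟩ := h
    have hsub := stem_plug_nil_subset f.2.1 ds (leaf z)
    refine ⟨h1, fun a ha hb => ?_, fun a ha hb => h3 a ha (hsub hb), ?_, h5, ih h6⟩
    · rcases hb with hb | hb
      · exact h2 a ha (Or.inl hb)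
      · exact h2 a ha (Or.inr (hsub hb))
    · intro a ha c hc
      cases ds with
      | nil => simp at hc
      | cons g ds => exact h4 a ha c (by simpa using hc)

theorem body_plug_subset (ds : List (Frame (ℤ × ℤ))) {d : BinaryTree (ℤ × ℤ)} {z p : ℤ × ℤ}
    (h : ds ≠ []) (hz : root? d = some z) : body (plug ds d) ⊆
      body (plug ds .nil) ∪ seg (lastPos p ds) z ∪ body d := by
  induction ds generalizing p with
  | nil => exact absurd rfl h
  | cons f ds ih =>
    intro a ha
    simp only [plug_cons, body_join, lastPos_cons] at ha ⊢
    cases ds with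
    | nil =>
      simp only [plug_nil, lastPos_nil, Set.mem_union, mem_stem (d := d)] at ha ⊢
      rw [hz] at ha
      simp only [Option.mem_def, Option.some.injEq, exists_eq_left'] at ha
      tauto
    | cons g ds =>
      have h0 := @ih f.2.1 (by simp) a
      simp only [Set.mem_union, plug_cons, stem_join] at h0 ha ⊢
      tauto

theorem lastPos_mem_body {ds : List (Frame (ℤ × ℤ))} (h : ds ≠ []) (p : ℤ × ℤ)
    (e : BinaryTree (ℤ × ℤ)) : toPlane (lastPos p ds) ∈ body (plug ds e) := by
  induction ds generalizing p with
  | nil => exact absurd rfl h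
  | cons f ds ih =>
    simp only [plug_cons, body_join, lastPos_cons]
    cases ds with
    | nil => simp
    | cons g ds =>
      exact Or.inr (Or.inr (body_subset_stem _ _ (ih (by simp) _)))

/-! ### Lattice isometries -/

/-- An affine map of the grid. -/
def aff (a b c d e f : ℤ) (p : ℤ × ℤ) : ℤ × ℤ := (a * p.1 + b * p.2 + e, c * p.1 + d * p.2 + f)

/-- The extension of `aff` to the plane. -/
def affR (a b c d e f : ℤ) (p : ℝ × ℝ) : ℝ × ℝ := (a * p.1 + b * p.2 + e, c * p.1 + d * p.2 + f)

section
variable (a b c d e f : ℤ)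

theorem toPlane_aff (p : ℤ × ℤ) : toPlane (aff a b c d e f p) = affR a b c d e f (toPlane p) := by
  simp [toPlane, aff, affR]

theorem seg_aff (p q : ℤ × ℤ) :
    seg (aff a b c d e f p) (aff a b c d e f q) = affR a b c d e f '' seg p q := by
  ext x
  simp only [Set.mem_image, mem_seg]
  constructor
  · rintro ⟨t, h0, h1, h2, h3⟩
    refine ⟨(p.1 + t * (q.1 - p.1), p.2 + t * (q.2 - p.2)), ⟨t, h0, h1, rfl, rfl⟩, ?_⟩
    ext
    · rw [h2]; simp [affR, aff]; ring
    · rw [h3]; simp [affR, aff]; ring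
  · rintro ⟨y, ⟨t, h0, h1, h2, h3⟩, rfl⟩
    refine ⟨t, h0, h1, ?_, ?_⟩
    · simp [affR, aff, h2, h3]; ring
    · simp [affR, aff, h2, h3]; ring

theorem stem_relabel (κ : Bool) (p : ℤ × ℤ) (t : BinaryTree (ℤ × ℤ)) :
    stem (aff a b c d e f p) (relabel κ (aff a b c d e f) t) = affR a b c d e f '' stem p t := by
  induction t generalizing p with
  | nil => simp
  | node v l r hl hr =>
    cases κ <;>
      simp [relabel, stem_node, body_node, seg_aff, Set.image_union, hl, hr, toPlane_aff,
        Set.image_insert_eq, Set.union_comm]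

theorem body_relabel (κ : Bool) (t : BinaryTree (ℤ × ℤ)) :
    body (relabel κ (aff a b c d e f) t) = affR a b c d e f '' body t := by
  cases t with
  | nil => simp
  | node v l r =>
    cases κ <;>
      simp [relabel, body_node, Set.image_union, stem_relabel, toPlane_aff, Set.image_insert_eq,
        Set.union_comm]

theorem affR_injective (h : a * d - b * c ≠ 0) : Function.Injective (affR a b c d e f) := by
  rintro ⟨x, y⟩ ⟨x', y'⟩ hxy
  simp only [affR, Prod.mk.injEq] at hxy
  have hR : (a * d - b * c : ℝ) ≠ 0 := by exact_mod_cast h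
  have hx : (a * d - b * c : ℝ) * (x - x') = 0 := by linear_combination d * hxy.1 - b * hxy.2
  have hy : (a * d - b * c : ℝ) * (y - y') = 0 := by linear_combination a * hxy.2 - c * hxy.1
  ext
  · simpa [hR, sub_eq_zero] using hx
  · simpa [hR, sub_eq_zero] using hy

theorem cr_aff (o p q : ℤ × ℤ) :
    cr (aff a b c d e f o) (aff a b c d e f p) (aff a b c d e f q) =
      (a * d - b * c) * cr o p q := by
  simp only [cr, aff]; ring

end

theorem cr_swap (o a b : ℤ × ℤ) : cr o a b = -cr o b a := by
  simp only [cr]; ring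

/-- Determinant 1 preserves cyclic orders. Determinant -1 reverses them, and exchanging left and
right children compensates for this. -/
theorem good_relabel {a b c d e f : ℤ} {κ : Bool} (h : a * d - b * c = bif κ then -1 else 1)
    {p : ℤ × ℤ} {t : BinaryTree (ℤ × ℤ)} (ht : Good p t) :
    Good (aff a b c d e f p) (relabel κ (aff a b c d e f) t) := by
  have hinj : Function.Injective (affR a b c d e f) :=
    affR_injective _ _ _ _ _ _ (by cases κ <;> simp_all)
  induction t generalizing p with
  | nil => trivial
  | node v l r hl hr =>
    obtain ⟨h1, h2, h3, h4, h5, h6⟩ := ht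
    have e1 : relabel κ (aff a b c d e f) (.node v l r) =
        join κ (aff a b c d e f v) (relabel κ (aff a b c d e f) l)
          (relabel κ (aff a b c d e f) r) := by
      cases κ <;> rfl
    rw [e1, good_join]
    refine ⟨fun hh => h1 (toPlane_injective (hinj ?_)), ?_, ?_, ?_, hl h5, hr h6⟩
    · rw [← toPlane_aff, ← toPlane_aff, hh]
    · rw [seg_aff, stem_relabel, stem_relabel, ← Set.image_union]
      rintro _ ⟨x, hx, rfl⟩ hx'
      rw [hinj.mem_set_image] at hx'
      rw [h2 x hx hx', toPlane_aff]
    · rw [stem_relabel, stem_relabel]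
      rintro _ ⟨x, hx, rfl⟩ hx'
      rw [hinj.mem_set_image] at hx'
      rw [h3 x hx hx', toPlane_aff]
    · intro x hx y hy
      rw [root?_relabel, Option.mem_map] at hx hy
      obtain ⟨x, hx, rfl⟩ := hx
      obtain ⟨y, hy, rfl⟩ := hy
      have := h4 x hx y hy
      cases κ
      · simpa [Ccw, cr_aff, h] using this
      · have c1 := cr_swap v p x
        have c2 := cr_swap v x y
        have c3 := cr_swap v y p
        simp only [cond_true, Ccw, cr_aff, h] at this ⊢
        omega

/-! ### From labelled trees to drawings -/

/-- The complex number `u` is the vector `(x', y')` turned back by `α`. A positive cross product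
means that its imaginary part is positive, so its argument lies strictly between 0 and π. -/
theorem exists_polar_of_cross_pos {α r x y x' y' : ℝ} (hr : 0 < r) (hx : x = r * Real.cos α)
    (hy : y = r * Real.sin α) (h : 0 < x * y' - y * x') :
    ∃ δ s : ℝ, 0 < δ ∧ δ < Real.pi ∧ 0 < s ∧ x' = s * Real.cos (α + δ) ∧
      y' = s * Real.sin (α + δ) := by
  set u : ℂ := ⟨Real.cos α * x' + Real.sin α * y', Real.cos α * y' - Real.sin α * x'⟩ with hu
  have him : 0 < u.im := by
    have : x * y' - y * x' = r * u.im := by rw [hx, hy, hu]; ring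
    rw [this] at h
    exact pos_of_mul_pos_right h hr.le
  have hu0 : u ≠ 0 := by
    intro h0; rw [h0] at him; simp at him
  have hre := Complex.norm_mul_cos_arg u
  have him' := Complex.norm_mul_sin_arg u
  refine ⟨u.arg, ‖u‖, ?_, ?_, norm_pos_iff.2 hu0, ?_, ?_⟩
  · rcases (Complex.arg_nonneg_iff.2 him.le).lt_or_eq with h | h
    · exact h
    · rw [← h] at him'; simp at him'; linarith
  · rcases (Complex.arg_le_pi u).lt_or_eq with h | h
    · exact h
    · rw [h] at him'; simp at him'; linarith
  · rw [Real.cos_add]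
    have := Real.sin_sq_add_cos_sq α
    have e1 : u.re = Real.cos α * x' + Real.sin α * y' := rfl
    have e2 : u.im = Real.cos α * y' - Real.sin α * x' := rfl
    rw [mul_sub, mul_left_comm, hre, mul_left_comm, him', e1, e2]
    linear_combination (-x') * this
  · rw [Real.sin_add]
    have := Real.sin_sq_add_cos_sq α
    have e1 : u.re = Real.cos α * x' + Real.sin α * y' := rfl
    have e2 : u.im = Real.cos α * y' - Real.sin α * x' := rfl
    rw [mul_add, mul_left_comm, hre, mul_left_comm, him', e1, e2]
    linear_combination (-y') * this

theorem isCounterclockwise_of_cr {o a b c : ℤ × ℤ} (h1 : 0 < cr o a b) (h2 : 0 < cr o b c) :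
    IsCounterclockwise (toPlane o) (toPlane a) (toPlane b) (toPlane c) := by
  have h1' : (0 : ℝ) < (a.1 - o.1) * (b.2 - o.2) - (a.2 - o.2) * (b.1 - o.1) := by
    exact_mod_cast h1
  have h2' : (0 : ℝ) < (b.1 - o.1) * (c.2 - o.2) - (b.2 - o.2) * (c.1 - o.1) := by
    exact_mod_cast h2
  set z : ℂ := ⟨a.1 - o.1, a.2 - o.2⟩ with hz
  have hz0 : z ≠ 0 := by
    intro h0
    have e1 := congrArg Complex.re h0
    have e2 := congrArg Complex.im h0
    simp only [hz, Complex.zero_re, Complex.zero_im] at e1 e2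
    rw [e1, e2] at h1'; simp at h1'
  have hr := norm_pos_iff.2 hz0
  have ha1 : (a.1 - o.1 : ℝ) = ‖z‖ * Real.cos z.arg := (Complex.norm_mul_cos_arg z).symm
  have ha2 : (a.2 - o.2 : ℝ) = ‖z‖ * Real.sin z.arg := (Complex.norm_mul_sin_arg z).symm
  obtain ⟨δ, s, d0, d1, hs, hb1, hb2⟩ := exists_polar_of_cross_pos hr ha1 ha2 h1'
  obtain ⟨ε, t, e0, e1, ht, hc1, hc2⟩ := exists_polar_of_cross_pos hs hb1 hb2 h2'
  refine ⟨z.arg, z.arg + δ, z.arg + δ + ε, ‖z‖, s, t, by linarith, by linarith, by linarith,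
    hr, hs, ht, ?_, ?_, ?_⟩
  · ext <;> simp only [toPlane, Prod.fst_add, Prod.snd_add, Prod.smul_fst, Prod.smul_snd, smul_eq_mul] <;> linarith
  · ext <;> simp only [toPlane, Prod.fst_add, Prod.snd_add, Prod.smul_fst, Prod.smul_snd, smul_eq_mul] <;> linarith
  · ext <;> simp only [toPlane, Prod.fst_add, Prod.snd_add, Prod.smul_fst, Prod.smul_snd, smul_eq_mul] <;> linarith

theorem IsCounterclockwise.rotate {o a b c : ℝ × ℝ} (h : IsCounterclockwise o b c a) :
    IsCounterclockwise o a b c := by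
  obtain ⟨α, β, γ, r, s, t, h1, h2, h3, hr, hs, ht, ha, hb, hc⟩ := h
  refine ⟨γ - 2 * Real.pi, α, β, t, r, s, by linarith, h1, by linarith, ht, hr, hs, ?_, ha, hb⟩
  rw [Real.cos_sub_two_pi, Real.sin_sub_two_pi, hc]

/-- The three successive turns between cyclically ordered directions add up to a full turn, so at
most one of them is a half turn or more. Two positive determinants therefore suffice, and the three
alternatives are rotations of one case. -/
theorem Ccw.isCounterclockwise {o a b c : ℤ × ℤ} (h : Ccw o a b c) :
    IsCounterclockwise (toPlane o) (toPlane a) (toPlane b) (toPlane c) := by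
  rcases h with ⟨h1, h2⟩ | ⟨h1, h2⟩ | ⟨h1, h2⟩
  · exact isCounterclockwise_of_cr h1 h2
  · exact (isCounterclockwise_of_cr h1 h2).rotate
  · exact (isCounterclockwise_of_cr h1 h2).rotate.rotate

-- Planarity and order from the local condition

/-- The label of the vertex `w` of a labelled tree. -/
def label : BinaryTree (ℤ × ℤ) → List Bool → ℤ × ℤ
  | .nil, _ => 0
  | .node v _ _, [] => v
  | .node _ l r, b :: w => label (bif b then r else l) w

theorem isVertex_cons {α : Type} {v : α} {l r : BinaryTree α} {b : Bool} {w : List Bool} :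
    IsVertex (shape (.node v l r)) (b :: w) ↔ IsVertex (shape (bif b then r else l)) w := by
  cases b <;> rfl

theorem isVertex_nil {t : BinaryTree (ℤ × ℤ)} (h : IsVertex (shape t) []) :
    root? t = some (label t []) := by
  cases t with
  | nil => exact absurd h (by simp [shape, IsVertex])
  | node v l r => rfl

theorem isEdge_node {α : Type} {v : α} {l r : BinaryTree α} {u w : List Bool}
    (h : IsEdge (shape (.node v l r)) u w) :
    ∃ b : Bool, (u = [] ∧ w = [b] ∧ IsVertex (shape (bif b then r else l)) []) ∨
      ∃ u' w', u = b :: u' ∧ w = b :: w' ∧ IsEdge (shape (bif b then r else l)) u' w' := by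
  obtain ⟨hw, c, rfl⟩ := h
  cases u with
  | nil => exact ⟨c, Or.inl ⟨rfl, rfl, isVertex_cons.1 hw⟩⟩
  | cons b u =>
    exact ⟨b, Or.inr ⟨u, u ++ [c], rfl, rfl, isVertex_cons.1 hw, c, rfl⟩⟩

theorem stem_child_subset {v : ℤ × ℤ} {l r : BinaryTree (ℤ × ℤ)} (b : Bool) :
    stem v (bif b then r else l) ⊆ body (.node v l r) := by
  rw [body_node]
  cases b
  · exact fun x hx => Or.inr (Or.inl hx)
  · exact fun x hx => Or.inr (Or.inr hx)

theorem isVertex_mem_body {d : BinaryTree (ℤ × ℤ)} {w : List Bool} (h : IsVertex (shape d) w) :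
    toPlane (label d w) ∈ body d := by
  induction d generalizing w with
  | nil => exact absurd h (by simp [shape, IsVertex])
  | node v l r hl hr =>
    cases w with
    | nil => exact root_mem_body rfl
    | cons b w =>
      rw [isVertex_cons] at h
      refine stem_child_subset b (body_subset_stem _ _ ?_)
      cases b
      · exact hl h
      · exact hr h

theorem seg_subset_stem {v a : ℤ × ℤ} {d : BinaryTree (ℤ × ℤ)} (h : root? d = some a) :
    seg v a ⊆ stem v d := fun _ hx => mem_stem.2 (Or.inl ⟨a, h, hx⟩)

theorem edge_subset_body {d : BinaryTree (ℤ × ℤ)} {u w : List Bool} (h : IsEdge (shape d) u w) :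
    edgeSegment (label d) u w ⊆ body d := by
  induction d generalizing u w with
  | nil => exact absurd h.1 (by simp [shape, IsVertex])
  | node v l r hl hr =>
    obtain ⟨b, ⟨rfl, rfl, hb⟩ | ⟨u', w', rfl, rfl, hb⟩⟩ := isEdge_node h
    · exact (seg_subset_stem (isVertex_nil hb)).trans (stem_child_subset b)
    · refine Set.Subset.trans ?_ ((body_subset_stem v _).trans (stem_child_subset b))
      cases b
      · exact hl hb
      · exact hr hb

theorem Good.root {p a : ℤ × ℤ} {d : BinaryTree (ℤ × ℤ)} (h : Good p d) (ha : root? d = some a) :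
    p ≠ a ∧ ∀ x ∈ seg p a, x ∈ body d → x = toPlane a := by
  cases d with
  | nil => simp at ha
  | node v l r =>
    simp only [root?_node, Option.some.injEq] at ha
    subst ha
    refine ⟨h.1, fun x hx hb => ?_⟩
    rw [body_node] at hb
    rcases hb with hb | hb
    · exact hb
    · exact h.2.1 x hx hb

theorem Good.not_mem {p : ℤ × ℤ} {d : BinaryTree (ℤ × ℤ)} (h : Good p d) : toPlane p ∉ body d := by
  intro hp
  cases d with
  | nil => simp at hp
  | node v l r =>
    obtain ⟨h1, h2⟩ := h.root rfl
    exact h1 (toPlane_injective (h2 _ (left_mem_seg _ _) hp))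

theorem Good.child {p v : ℤ × ℤ} {l r : BinaryTree (ℤ × ℤ)} (h : Good p (.node v l r)) (b : Bool) :
    Good v (bif b then r else l) := by
  cases b
  · exact h.2.2.2.2.1
  · exact h.2.2.2.2.2

theorem Good.stem_inter {p v : ℤ × ℤ} {l r : BinaryTree (ℤ × ℤ)} (h : Good p (.node v l r))
    {b c : Bool} (hbc : b ≠ c) {x : ℝ × ℝ} (hb : x ∈ stem v (bif b then r else l))
    (hc : x ∈ stem v (bif c then r else l)) : x = toPlane v := by
  cases b <;> cases c <;> simp_all only [ne_eq, not_true_eq_false, cond_true, cond_false]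
  · exact h.2.2.1 x hb hc
  · exact h.2.2.1 x hc hb

/-- The two branches share only `v`, and `v` itself is not on the drawing of a child's subtree. This
disposes of all cases below in which two objects lie in different branches. -/
theorem Good.body_disjoint {p v : ℤ × ℤ} {l r : BinaryTree (ℤ × ℤ)} (h : Good p (.node v l r))
    {b c : Bool} (hbc : b ≠ c) {x : ℝ × ℝ} (hb : x ∈ body (bif b then r else l))
    (hc : x ∈ stem v (bif c then r else l)) : False := by
  have := h.stem_inter hbc (body_subset_stem _ _ hb) hc
  subst this
  exact (h.child b).not_mem hb

theorem Good.label_injective {p : ℤ × ℤ} {d : BinaryTree (ℤ × ℤ)} (h : Good p d) :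
    ∀ u w, IsVertex (shape d) u → IsVertex (shape d) w → label d u = label d w → u = w := by
  induction d generalizing p with
  | nil => intro u w hu; exact absurd hu (by simp [shape, IsVertex])
  | node v l r hl hr =>
    intro u w hu hw huw
    cases u with
    | nil =>
      cases w with
      | nil => rfl
      | cons b w =>
        rw [isVertex_cons] at hw
        have := isVertex_mem_body hw
        have e : label (.node v l r) (b :: w) = label (bif b then r else l) w := rfl
        rw [← e, ← huw] at this
        exact absurd this (h.child b).not_mem
    | cons b u =>
      rw [isVertex_cons] at hu
      have mu := isVertex_mem_body hu
      have e : label (.node v l r) (b :: u) = label (bif b then r else l) u := rfl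
      cases w with
      | nil =>
        rw [← e, huw] at mu
        exact absurd mu (h.child b).not_mem
      | cons c w =>
        rw [isVertex_cons] at hw
        have mw := isVertex_mem_body hw
        have e' : label (.node v l r) (c :: w) = label (bif c then r else l) w := rfl
        by_cases hbc : b = c
        · subst hbc
          rw [e, e'] at huw
          congr 1
          cases b
          · exact hl (h.child false) u w hu hw huw
          · exact hr (h.child true) u w hu hw huw
        · rw [← e, huw, e'] at mu
          exact (h.body_disjoint hbc mu (body_subset_stem _ _ mw)).elim

theorem Good.vertex_edge {p : ℤ × ℤ} {d : BinaryTree (ℤ × ℤ)} (h : Good p d) :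
    ∀ w u v, IsVertex (shape d) w → IsEdge (shape d) u v →
      toPlane (label d w) ∈ edgeSegment (label d) u v → w = u ∨ w = v := by
  induction d generalizing p with
  | nil => intro w u v hw; exact absurd hw (by simp [shape, IsVertex])
  | node x l r hl hr =>
    intro w u v hw huv hmem
    obtain ⟨b, ⟨rfl, rfl, hb⟩ | ⟨u', v', rfl, rfl, hb⟩⟩ := isEdge_node huv
    · cases w with
      | nil => exact Or.inl rfl
      | cons c w =>
        right
        have hroot := isVertex_nil hb
        have hmem' : toPlane (label (bif c then r else l) w) ∈
          seg x (label (bif b then r else l) []) := hmem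
        rw [isVertex_cons] at hw
        have mw := isVertex_mem_body hw
        by_cases hbc : c = b
        · subst hbc
          have := toPlane_injective (((h.child c).root hroot).2 _ hmem' mw)
          rw [(h.child c).label_injective _ _ hw hb this]
        · exact (h.body_disjoint hbc mw (seg_subset_stem hroot hmem')).elim
    · have hsub := edge_subset_body hb
      have hmem' : toPlane (label (.node x l r) w) ∈
        edgeSegment (label (bif b then r else l)) u' v' := hmem
      cases w with
      | nil => exact absurd (hsub hmem') (h.child b).not_mem
      | cons c w =>
        rw [isVertex_cons] at hw
        have mw := isVertex_mem_body hw
        by_cases hbc : c = b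
        · subst hbc
          simp only [List.cons.injEq, true_and]
          cases c
          · exact hl (h.child false) w u' v' hw hb hmem'
          · exact hr (h.child true) w u' v' hw hb hmem'
        · exact (h.body_disjoint hbc mw (body_subset_stem _ _ (hsub hmem'))).elim

theorem Good.edge_edge {p : ℤ × ℤ} {d : BinaryTree (ℤ × ℤ)} (h : Good p d) :
    ∀ u v u' v', IsEdge (shape d) u v → IsEdge (shape d) u' v' → (u, v) ≠ (u', v') →
    ∀ x ∈ edgeSegment (label d) u v ∩ edgeSegment (label d) u' v',
      ∃ w, (w = u ∨ w = v) ∧ (w = u' ∨ w = v') ∧ x = toPlane (label d w) := by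
  induction d generalizing p with
  | nil => intro u v _ _ hw; exact absurd hw.1 (by simp [shape, IsVertex])
  | node y l r hl hr =>
    have key : ∀ (b c : Bool) (u' v' : List Bool) (x : ℝ × ℝ),
        IsVertex (shape (bif b then r else l)) [] → IsEdge (shape (bif c then r else l)) u' v' →
        x ∈ edgeSegment (label (.node y l r)) [] [b] →
        x ∈ edgeSegment (label (.node y l r)) (c :: u') (c :: v') →
        ∃ w, (w = [] ∨ w = [b]) ∧ (w = c :: u' ∨ w = c :: v') ∧
          x = toPlane (label (.node y l r) w) := by
      intro b c u' v' x hb hc hx hx'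
      have hroot := isVertex_nil hb
      have hxs : x ∈ seg y (label (bif b then r else l) []) := hx
      have hsub := edge_subset_body hc
      by_cases hbc : c = b
      · subst hbc
        have e := ((h.child c).root hroot).2 _ hxs (hsub hx')
        subst e
        have := (h.child c).vertex_edge [] u' v' hb hc hx'
        refine ⟨[c], Or.inr rfl, ?_, rfl⟩
        simpa using this
      · exact (h.body_disjoint hbc (hsub hx') (seg_subset_stem hroot hxs)).elim
    rintro u v u' v' huv huv' hne x ⟨hx, hx'⟩
    obtain ⟨b, ⟨rfl, rfl, hb⟩ | ⟨u1, v1, rfl, rfl, hb⟩⟩ := isEdge_node huv <;>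
    obtain ⟨c, ⟨rfl, rfl, hc⟩ | ⟨u2, v2, rfl, rfl, hc⟩⟩ := isEdge_node huv'
    · have hbc : b ≠ c := by rintro rfl; exact hne rfl
      exact ⟨[], Or.inl rfl, Or.inl rfl, h.stem_inter hbc (seg_subset_stem (isVertex_nil hb) hx)
        (seg_subset_stem (isVertex_nil hc) hx')⟩
    · exact key b c u2 v2 x hb hc hx hx'
    · obtain ⟨w, h1, h2, h3⟩ := key c b u1 v1 x hc hb hx' hx
      exact ⟨w, h2, h1, h3⟩
    · by_cases hbc : b = c
      · subst hbc
        have hne' : (u1, v1) ≠ (u2, v2) := by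
          rintro e; simp only [Prod.mk.injEq] at e; exact hne (by rw [e.1, e.2])
        have : ∃ w, (w = u1 ∨ w = v1) ∧ (w = u2 ∨ w = v2) ∧
            x = toPlane (label (bif b then r else l) w) := by
          cases b
          · exact hl (h.child false) u1 v1 u2 v2 hb hc hne' x ⟨hx, hx'⟩
          · exact hr (h.child true) u1 v1 u2 v2 hb hc hne' x ⟨hx, hx'⟩
        obtain ⟨w, h1, h2, h3⟩ := this
        exact ⟨b :: w, by simpa using h1, by simpa using h2, h3⟩
      · exact (h.body_disjoint hbc (edge_subset_body hb hx)
          (body_subset_stem _ _ (edge_subset_body hc hx'))).elim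

theorem isVertex_child_nil {d : BinaryTree (ℤ × ℤ)} {v : ℤ × ℤ} {l r : BinaryTree (ℤ × ℤ)}
    (hd : d = .node v l r) {b : Bool} (h : IsVertex (shape d) [b]) :
    root? (bif b then r else l) = some (label d [b]) := by
  subst hd
  exact isVertex_nil (isVertex_cons.1 h)

theorem Good.isOrderPreserving {p : ℤ × ℤ} {d : BinaryTree (ℤ × ℤ)} (h : Good p d) :
    IsOrderPreserving (shape d) (label d) := by
  induction d generalizing p with
  | nil => intro u v hw; exact absurd hw.1 (by simp [shape, IsVertex])
  | node x l r hl hr =>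
    intro u v huv h0 h1
    obtain ⟨b, ⟨rfl, rfl, hb⟩ | ⟨u', v', rfl, rfl, hb⟩⟩ := isEdge_node huv
    · have hg := h.child b
      have e0 : IsVertex (shape (bif b then r else l)) [false] := isVertex_cons.1 h0
      have e1 : IsVertex (shape (bif b then r else l)) [true] := isVertex_cons.1 h1
      change IsCounterclockwise (toPlane (label (bif b then r else l) [])) (toPlane x)
        (toPlane (label (bif b then r else l) [false]))
        (toPlane (label (bif b then r else l) [true]))
      generalize (bif b then r else l) = d at hg e0 e1
      cases d with
      | nil => exact absurd e0 (by simp [shape, IsVertex])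
      | node y l' r' =>
        exact (hg.2.2.2.1 _ (isVertex_child_nil rfl e0) _ (isVertex_child_nil rfl e1)).isCounterclockwise
    · cases b
      · exact hl (h.child false) u' v' hb (isVertex_cons.1 h0) (isVertex_cons.1 h1)
      · exact hr (h.child true) u' v' hb (isVertex_cons.1 h0) (isVertex_cons.1 h1)

/-- A good labelled tree inside `[1, W] × [1, H]` is a planar order-preserving drawing. -/
theorem Good.isPlanarDrawing {p : ℤ × ℤ} {d : BinaryTree (ℤ × ℤ)} {W H : ℕ} (h : Good p d)
    (hbox : ∀ a ∈ body d, 1 ≤ a.1 ∧ a.1 ≤ W ∧ 1 ≤ a.2 ∧ a.2 ≤ H) :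
    IsPlanarDrawing (shape d) W H (label d) where
  mem_grid v hv := by
    have := hbox _ (isVertex_mem_body hv)
    simp only [toPlane] at this
    refine ⟨⟨?_, ?_⟩, ?_, ?_⟩
    · exact_mod_cast this.1
    · exact_mod_cast this.2.1
    · exact_mod_cast this.2.2.1
    · exact_mod_cast this.2.2.2
  injective := h.label_injective
  vertex_edge := h.vertex_edge
  edge_edge := h.edge_edge

/-! ### Bounds for segments -/

theorem seg_symm (p q : ℤ × ℤ) : seg p q = seg q p := segment_symm _ _ _

section
variable {p q : ℤ × ℤ} {a : ℝ × ℝ}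

theorem seg_fst_le (h : a ∈ seg p q) {k : ℝ} (hp : (p.1 : ℝ) ≤ k) (hq : (q.1 : ℝ) ≤ k) :
    a.1 ≤ k := by
  obtain ⟨t, h0, h1, h2, -⟩ := mem_seg.1 h
  nlinarith [mul_le_mul_of_nonneg_left hq h0, mul_le_mul_of_nonneg_left hp (sub_nonneg.2 h1)]

theorem le_seg_fst (h : a ∈ seg p q) {k : ℝ} (hp : k ≤ (p.1 : ℝ)) (hq : k ≤ (q.1 : ℝ)) :
    k ≤ a.1 := by
  obtain ⟨t, h0, h1, h2, -⟩ := mem_seg.1 h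
  nlinarith [mul_le_mul_of_nonneg_left hq h0, mul_le_mul_of_nonneg_left hp (sub_nonneg.2 h1)]

theorem seg_snd_le (h : a ∈ seg p q) {k : ℝ} (hp : (p.2 : ℝ) ≤ k) (hq : (q.2 : ℝ) ≤ k) :
    a.2 ≤ k := by
  obtain ⟨t, h0, h1, -, h2⟩ := mem_seg.1 h
  nlinarith [mul_le_mul_of_nonneg_left hq h0, mul_le_mul_of_nonneg_left hp (sub_nonneg.2 h1)]

theorem le_seg_snd (h : a ∈ seg p q) {k : ℝ} (hp : k ≤ (p.2 : ℝ)) (hq : k ≤ (q.2 : ℝ)) :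
    k ≤ a.2 := by
  obtain ⟨t, h0, h1, -, h2⟩ := mem_seg.1 h
  nlinarith [mul_le_mul_of_nonneg_left hq h0, mul_le_mul_of_nonneg_left hp (sub_nonneg.2 h1)]

theorem seg_eq_left {t : ℝ} (ht : t = 0) (h1 : a.1 = p.1 + t * (q.1 - p.1))
    (h2 : a.2 = p.2 + t * (q.2 - p.2)) : a = toPlane p := by
  subst ht
  ext <;> simp [toPlane, h1, h2]

/-- This and its three variants are the basic separation tool: a segment that leaves a closed
half-plane at a boundary point meets it nowhere else. -/
theorem eq_left_of_fst_le (h : a ∈ seg p q) (hpq : p.1 < q.1) (ha : a.1 ≤ p.1) :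
    a = toPlane p := by
  obtain ⟨t, h0, h1, h2, h3⟩ := mem_seg.1 h
  have hR : (p.1 : ℝ) < q.1 := by exact_mod_cast hpq
  exact seg_eq_left (by nlinarith) h2 h3

theorem eq_left_of_le_fst (h : a ∈ seg p q) (hpq : q.1 < p.1) (ha : (p.1 : ℝ) ≤ a.1) :
    a = toPlane p := by
  obtain ⟨t, h0, h1, h2, h3⟩ := mem_seg.1 h
  have hR : (q.1 : ℝ) < p.1 := by exact_mod_cast hpq
  exact seg_eq_left (by nlinarith) h2 h3

theorem eq_left_of_snd_le (h : a ∈ seg p q) (hpq : p.2 < q.2) (ha : a.2 ≤ p.2) :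
    a = toPlane p := by
  obtain ⟨t, h0, h1, h2, h3⟩ := mem_seg.1 h
  have hR : (p.2 : ℝ) < q.2 := by exact_mod_cast hpq
  exact seg_eq_left (by nlinarith) h2 h3

theorem eq_left_of_le_snd (h : a ∈ seg p q) (hpq : q.2 < p.2) (ha : (p.2 : ℝ) ≤ a.2) :
    a = toPlane p := by
  obtain ⟨t, h0, h1, h2, h3⟩ := mem_seg.1 h
  have hR : (q.2 : ℝ) < p.2 := by exact_mod_cast hpq
  exact seg_eq_left (by nlinarith) h2 h3

end

/-! ### Drawings in boxes -/

/-- The drawing `d` lies in the box `[x₀, x₁] × [y₀, y₁]`. -/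
def InBox (d : BinaryTree (ℤ × ℤ)) (x₀ x₁ y₀ y₁ : ℤ) : Prop :=
  ∀ a ∈ body d, (x₀ : ℝ) ≤ a.1 ∧ a.1 ≤ x₁ ∧ (y₀ : ℝ) ≤ a.2 ∧ a.2 ≤ y₁

theorem InBox.point {d : BinaryTree (ℤ × ℤ)} {x₀ x₁ y₀ y₁ : ℤ} (h : InBox d x₀ x₁ y₀ y₁)
    {v : ℤ × ℤ} (hv : toPlane v ∈ body d) : x₀ ≤ v.1 ∧ v.1 ≤ x₁ ∧ y₀ ≤ v.2 ∧ v.2 ≤ y₁ := by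
  have := h _ hv
  simp only [toPlane] at this
  exact_mod_cast this

theorem InBox.root {d : BinaryTree (ℤ × ℤ)} {x₀ x₁ y₀ y₁ : ℤ} (h : InBox d x₀ x₁ y₀ y₁)
    {v : ℤ × ℤ} (hv : v ∈ root? d) : x₀ ≤ v.1 ∧ v.1 ≤ x₁ ∧ y₀ ≤ v.2 ∧ v.2 ≤ y₁ :=
  h.point (root_mem_body hv)

theorem InBox.mono {d : BinaryTree (ℤ × ℤ)} {x₀ x₁ y₀ y₁ x₀' x₁' y₀' y₁' : ℤ}
    (h : InBox d x₀ x₁ y₀ y₁) (h1 : x₀' ≤ x₀) (h2 : x₁ ≤ x₁') (h3 : y₀' ≤ y₀) (h4 : y₁ ≤ y₁') :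
    InBox d x₀' x₁' y₀' y₁' := by
  intro a ha
  obtain ⟨e1, e2, e3, e4⟩ := h a ha
  refine ⟨le_trans ?_ e1, e2.trans ?_, le_trans ?_ e3, e4.trans ?_⟩ <;> exact_mod_cast ‹_›

/-- The tree `t` has a drawing in the box `[0, W] × [0, H]` with its root on the left side, to
which a parent can be attached anywhere to the left of the box. -/
def TreeDraw (t : BinaryTree Unit) (W H : ℤ) : Prop :=
  ∃ d, shape d = t ∧ InBox d 0 W 0 H ∧ (∀ v ∈ root? d, v.1 = 0) ∧ ∀ p : ℤ × ℤ, p.1 < 0 → Good p d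

/-- The spine `s` has a drawing in the box `[0, W] × [0, H]` with the first vertex on the left side
and the last vertex alone on the lower side. Something may be attached to the last vertex anywhere
else below this side, and to the first vertex anywhere above the box at abscissa at most `0`. -/
def SpineDraw (s : List (Frame Unit)) (W H : ℤ) : Prop :=
  ∃ ds : List (Frame (ℤ × ℤ)), ds.map shapeF = s ∧ ds ≠ [] ∧ InBox (plug ds .nil) 0 W 0 H ∧
    (∀ v ∈ root? (plug ds .nil), v.1 = 0) ∧ (∀ p, (lastPos p ds).2 = 0) ∧
    (∀ p z : ℤ × ℤ, p.1 ≤ 0 → H < p.2 → z.2 ≤ 0 → z ≠ lastPos p ds →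
      Good p (plug ds (leaf z))) ∧
    ∀ p : ℤ × ℤ, p.1 < 0 → Good p (plug ds .nil)

theorem TreeDraw.mono {t : BinaryTree Unit} {W H W' H' : ℤ} (h : TreeDraw t W H) (hW : W ≤ W')
    (hH : H ≤ H') : TreeDraw t W' H' := by
  obtain ⟨d, h1, h2, h3, h4⟩ := h
  exact ⟨d, h1, h2.mono le_rfl hW le_rfl hH, h3, h4⟩

theorem SpineDraw.mono {s : List (Frame Unit)} {W H W' H' : ℤ} (h : SpineDraw s W H)
    (hW : W ≤ W') (hH : H ≤ H') : SpineDraw s W' H' := by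
  obtain ⟨d, h1, h2, h3, h4, h5, h6, h7⟩ := h
  exact ⟨d, h1, h2, h3.mono le_rfl hW le_rfl hH, h4, h5,
    fun p z hp hp' => h6 p z hp (by omega), h7⟩

theorem treeDraw_nil (W H : ℤ) : TreeDraw .nil W H :=
  ⟨.nil, rfl, by simp [InBox], by simp, fun _ _ => trivial⟩

-- Moving tree drawings by translation, rotation and reflection

theorem InBox.relabel {d : BinaryTree (ℤ × ℤ)} {κ : Bool} {a b c d' e f : ℤ}
    {x₀ x₁ y₀ y₁ : ℤ}
    (h : ∀ x ∈ body d, (x₀ : ℝ) ≤ a * x.1 + b * x.2 + e ∧ a * x.1 + b * x.2 + e ≤ x₁ ∧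
      (y₀ : ℝ) ≤ c * x.1 + d' * x.2 + f ∧ c * x.1 + d' * x.2 + f ≤ y₁) :
    InBox (relabel κ (aff a b c d' e f) d) x₀ x₁ y₀ y₁ := by
  intro x hx
  rw [body_relabel] at hx
  obtain ⟨y, hy, rfl⟩ := hx
  exact h y hy

theorem shape_relabel_true (f : ℤ × ℤ → ℤ × ℤ) {d : BinaryTree (ℤ × ℤ)} {t : BinaryTree Unit}
    (h : shape d = mirror t) : shape (relabel true f d) = t := by
  rw [shape_relabel, h]; simp

theorem shape_relabel_false (f : ℤ × ℤ → ℤ × ℤ) {d : BinaryTree (ℤ × ℤ)} {t : BinaryTree Unit}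
    (h : shape d = t) : shape (relabel false f d) = t := by
  rw [shape_relabel, h]; simp

/-- Translating a drawing. -/
theorem TreeDraw.left {t : BinaryTree Unit} {W H : ℤ} (h : TreeDraw t W H) (x y : ℤ) :
    ∃ d, shape d = t ∧ InBox d x (x + W) y (y + H) ∧ (∀ v ∈ root? d, v.1 = x) ∧
      ∀ p : ℤ × ℤ, p.1 < x → Good p d := by
  obtain ⟨d, h1, h2, h3, h4⟩ := h
  refine ⟨relabel false (aff 1 0 0 1 x y) d, shape_relabel_false _ h1, InBox.relabel ?_, ?_, ?_⟩
  · intro a ha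
    have := h2 a ha
    push_cast at *
    refine ⟨?_, ?_, ?_, ?_⟩ <;> linarith
  · intro v hv
    rw [root?_relabel, Option.mem_map] at hv
    obtain ⟨w, hw, rfl⟩ := hv
    simp [aff, h3 w hw]
  · intro p hp
    have := good_relabel (a := 1) (b := 0) (c := 0) (d := 1) (e := x) (f := y) (κ := false)
      (by simp) (h4 (p.1 - x, p.2 - y) (by simp; omega))
    convert this using 1
    simp [aff]

/-- Rotating a drawing so that its root comes to lie on the lower side. -/
theorem TreeDraw.below {t : BinaryTree Unit} {W H : ℤ} (h : TreeDraw t W H) (x y : ℤ) :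
    ∃ d, shape d = t ∧ InBox d x (x + H) y (y + W) ∧ (∀ v ∈ root? d, v.2 = y) ∧
      ∀ p : ℤ × ℤ, p.2 < y → Good p d := by
  obtain ⟨d, h1, h2, h3, h4⟩ := h
  refine ⟨relabel false (aff 0 (-1) 1 0 (x + H) y) d, shape_relabel_false _ h1,
    InBox.relabel ?_, ?_, ?_⟩
  · intro a ha
    have := h2 a ha
    push_cast at *
    refine ⟨?_, ?_, ?_, ?_⟩ <;> linarith
  · intro v hv
    rw [root?_relabel, Option.mem_map] at hv
    obtain ⟨w, hw, rfl⟩ := hv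
    simp [aff, h3 w hw]
  · intro p hp
    have := good_relabel (a := 0) (b := -1) (c := 1) (d := 0) (e := x + H) (f := y) (κ := false)
      (by simp) (h4 (p.2 - y, x + H - p.1) (by simp; omega))
    convert this using 1
    simp [aff]

/-- A drawing of `t` with the root on the right side, from one of its mirror image. -/
theorem TreeDraw.right {t : BinaryTree Unit} {W H : ℤ} (h : TreeDraw (mirror t) W H) (x y : ℤ) :
    ∃ d, shape d = t ∧ InBox d x (x + W) y (y + H) ∧ (∀ v ∈ root? d, v.1 = x + W) ∧
      ∀ p : ℤ × ℤ, x + W < p.1 → Good p d := by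
  obtain ⟨d, h1, h2, h3, h4⟩ := h
  refine ⟨relabel true (aff (-1) 0 0 1 (x + W) y) d, shape_relabel_true _ h1,
    InBox.relabel ?_, ?_, ?_⟩
  · intro a ha
    have := h2 a ha
    push_cast at *
    refine ⟨?_, ?_, ?_, ?_⟩ <;> linarith
  · intro v hv
    rw [root?_relabel, Option.mem_map] at hv
    obtain ⟨w, hw, rfl⟩ := hv
    simp [aff, h3 w hw]
  · intro p hp
    have := good_relabel (a := -1) (b := 0) (c := 0) (d := 1) (e := x + W) (f := y) (κ := true)
      (by simp) (h4 (x + W - p.1, p.2 - y) (by simp; omega))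
    convert this using 1
    simp [aff]

/-- The mirror image of a tree has a drawing in a box of the same size. -/
theorem TreeDraw.mirror {t : BinaryTree Unit} {W H : ℤ} (h : TreeDraw t W H) :
    TreeDraw (mirror t) W H := by
  obtain ⟨d, h1, h2, h3, h4⟩ := h
  refine ⟨relabel true (aff 1 0 0 (-1) 0 H) d, shape_relabel_true _ (by simpa using h1),
    InBox.relabel ?_, ?_, ?_⟩
  · intro a ha
    have := h2 a ha
    push_cast at *
    refine ⟨?_, ?_, ?_, ?_⟩ <;> linarith
  · intro v hv
    rw [root?_relabel, Option.mem_map] at hv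
    obtain ⟨w, hw, rfl⟩ := hv
    simp [aff, h3 w hw]
  · intro p hp
    have := good_relabel (a := 1) (b := 0) (c := 0) (d := -1) (e := 0) (f := H) (κ := true)
      (by simp) (h4 (p.1, H - p.2) (by simpa))
    convert this using 1
    simp [aff]

theorem mirror_plug (s : List (Frame Unit)) (e : BinaryTree Unit) :
    BinaryTreeDrawing.mirror (plug s e) = plug (s.map mirrorF) (BinaryTreeDrawing.mirror e) :=
  relabel_plug true id s e

/-- A drawing of a spine, or of its mirror image, gives a drawing of the tree. -/
theorem SpineDraw.treeDraw {s : List (Frame Unit)} {W H : ℤ}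
    (h : SpineDraw s W H ∨ SpineDraw (s.map mirrorF) W H) : TreeDraw (plug s .nil) W H := by
  have key : ∀ s : List (Frame Unit), SpineDraw s W H → TreeDraw (plug s .nil) W H := by
    rintro _ ⟨ds, rfl, h2, h3, h4, h5, h6, h7⟩
    exact ⟨plug ds .nil, shape_plug ds .nil, h3, h4, h7⟩
  rcases h with h | h
  · exact key s h
  · have := (key _ h).mirror
    rwa [mirror_plug, BinaryTreeDrawing.mirror, relabel_nil, map_mirrorF_map_mirrorF] at this

-- Spines with one or two vertices, and stacking

theorem mem_stem_leaf {p z : ℤ × ℤ} {a : ℝ × ℝ} : a ∈ stem p (leaf z) ↔ a ∈ seg p z := by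
  rw [mem_stem]
  simp only [root?_leaf, Option.mem_def, Option.some.injEq, exists_eq_left', body_leaf,
    Set.mem_singleton_iff, or_iff_left_iff_imp]
  rintro rfl
  exact right_mem_seg _ _

/-- A spine with one vertex. -/
theorem spineDraw_singleton_of_good {d : BinaryTree (ℤ × ℤ)} {W H : ℤ} (hW : 0 ≤ W) (hH : 0 ≤ H)
    (hbox : InBox d 1 W 1 H) (hd : Good (0, 0) d) :
    SpineDraw [(true, (), shape d)] W H := by
  -- Apart from the origin, the subtree and its edge lie in the open first quadrant. The edge to the
  -- parent stays in `a.1 ≤ 0` and the edge to the continuation in `a.2 ≤ 0`, so neither meets them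
  -- elsewhere.
  have hstem : ∀ a ∈ stem (0, 0) d, a = toPlane (0, 0) ∨ (0 < a.1 ∧ 0 < a.2) := by
    intro a ha
    rcases mem_stem.1 ha with ⟨v, hv, ha⟩ | ha
    · obtain ⟨h1, -, h2, -⟩ := hbox.root hv
      by_cases h : a.1 ≤ 0
      · exact Or.inl (eq_left_of_fst_le ha (by simp; omega) (by simpa using h))
      by_cases h' : a.2 ≤ 0
      · exact Or.inl (eq_left_of_snd_le ha (by simp; omega) (by simpa using h'))
      exact Or.inr ⟨not_le.1 h, not_le.1 h'⟩
    · obtain ⟨h1, -, h2, -⟩ := hbox a ha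
      push_cast at h1 h2
      exact Or.inr ⟨by linarith, by linarith⟩
  have hstem' : ∀ a ∈ stem (0, 0) d, 0 ≤ a.1 ∧ a.1 ≤ W ∧ 0 ≤ a.2 ∧ a.2 ≤ H := by
    have hWR : (0 : ℝ) ≤ W := by exact_mod_cast hW
    have hHR : (0 : ℝ) ≤ H := by exact_mod_cast hH
    intro a ha
    rcases mem_stem.1 ha with ⟨v, hv, ha⟩ | ha
    · obtain ⟨h1, h2, h3, h4⟩ := hbox.root hv
      have h1' : (1 : ℝ) ≤ v.1 := by exact_mod_cast h1
      have h2' : (v.1 : ℝ) ≤ W := by exact_mod_cast h2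
      have h3' : (1 : ℝ) ≤ v.2 := by exact_mod_cast h3
      have h4' : (v.2 : ℝ) ≤ H := by exact_mod_cast h4
      exact ⟨le_seg_fst ha (by simp) (by linarith), seg_fst_le ha (by simpa using hWR) h2',
        le_seg_snd ha (by simp) (by linarith), seg_snd_le ha (by simpa using hHR) h4'⟩
    · obtain ⟨h1, h2, h3, h4⟩ := hbox a ha
      push_cast at h1 h3
      exact ⟨by linarith, h2, by linarith, h4⟩
  refine ⟨[(true, (0, 0), d)], rfl, by simp, ?_, by simp, by simp, ?_, ?_⟩
  · intro a ha
    simp only [plug_cons, plug_nil, body_join, stem_nil, Set.union_empty] at ha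
    push_cast
    rcases ha with rfl | ha
    · simp only [toPlane]
      refine ⟨by simp, ?_, by simp, ?_⟩ <;> simpa
    · exact hstem' a ha
  · intro p z hp hp' hz hzq
    simp only [lastPos_cons, lastPos_nil] at hzq
    simp only [plug_cons, plug_nil]
    have hzn : ∀ a ∈ seg (0, 0) z, a.2 ≤ 0 := fun a ha =>
      seg_snd_le ha (by simp) (by exact_mod_cast hz)
    have hpn : ∀ a ∈ seg p (0, 0), a.1 ≤ 0 := fun a ha =>
      seg_fst_le ha (by exact_mod_cast hp) (by simp)
    refine good_join.2 ⟨?_, ?_, ?_, ?_, hd, good_leaf.2 hzq.symm⟩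
    · rintro rfl; simp at hp'; omega
    · rintro a ha (hb | hb)
      · rcases hstem a hb with h | h
        · exact h
        · linarith [hpn a ha]
      · rw [mem_stem_leaf] at hb
        rw [seg_symm] at ha
        exact eq_left_of_snd_le ha (by simp; omega) (by simpa using hzn a hb)
    · intro a ha hb
      rw [mem_stem_leaf] at hb
      rcases hstem a ha with h | h
      · exact h
      · linarith [hzn a hb]
    · intro v hv c hc
      simp only [root?_leaf, Option.mem_def, Option.some.injEq] at hc
      subst hc
      obtain ⟨h1, -, h3, -⟩ := hbox.root hv
      obtain ⟨x, y⟩ := v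
      obtain ⟨p, q⟩ := p
      obtain ⟨z, w⟩ := z
      simp only [cond_true, Ccw, cr, sub_zero] at *
      have hq : 0 < q := by omega
      have e1 : 0 < x * q - y * p := by nlinarith [mul_pos (show 0 < x by omega) hq, mul_nonneg (show 0 ≤ y by omega) (neg_nonneg.2 hp)]
      -- The turn from the subtree to the parent is always less than a half turn. Which other turn
      -- is also less than a half turn depends on the side to which the continuation leaves.
      rcases lt_trichotomy z 0 with hz0 | hz0 | hz0
      · have : 0 < p * w - q * z := by nlinarith [mul_pos hq (neg_pos.2 hz0), mul_nonneg (neg_nonneg.2 hp) (neg_nonneg.2 hz)]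
        exact Or.inr (Or.inr ⟨e1, this⟩)
      · subst hz0
        have hw : w < 0 := lt_of_le_of_ne hz (by rintro rfl; exact hzq rfl)
        exact Or.inr (Or.inl ⟨by nlinarith [mul_pos (show 0 < x by omega) (neg_pos.2 hw)], e1⟩)
      · exact Or.inr (Or.inl ⟨by nlinarith [mul_pos (show 0 < y by omega) hz0, mul_nonneg (show 0 ≤ x by omega) (neg_nonneg.2 hz)], e1⟩)
  · intro p hp
    simp only [plug_cons, plug_nil]
    refine good_join.2 ⟨by rintro rfl; simp at hp, ?_, by simp, by simp [OrdSide], hd, trivial⟩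
    intro a ha hb
    rw [stem_nil, Set.union_empty] at hb
    rw [seg_symm] at ha
    exact eq_left_of_le_fst ha (by simpa) (by simpa using (hstem' a hb).1)

/-- A spine with one vertex, with the subtree drawn upright. -/
theorem spineDraw_singleton {t : BinaryTree Unit} {W H : ℤ} (hW : 0 ≤ W) (hH : 0 ≤ H)
    (h : TreeDraw t W H) : SpineDraw [(true, (), t)] (W + 1) (H + 1) := by
  obtain ⟨d, rfl, h2, -, h4⟩ := h.left 1 1
  exact spineDraw_singleton_of_good (by omega) (by omega)
    (h2.mono le_rfl (by omega) le_rfl (by omega)) (h4 _ (by simp))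

/-- A spine with one vertex, with the subtree drawn lying on its side. -/
theorem spineDraw_singleton_rotated {t : BinaryTree Unit} {W H : ℤ} (hW : 0 ≤ W) (hH : 0 ≤ H)
    (h : TreeDraw t W H) : SpineDraw [(true, (), t)] (H + 1) (W + 1) := by
  obtain ⟨d, rfl, h2, -, h4⟩ := h.below 1 1
  exact spineDraw_singleton_of_good (by omega) (by omega)
    (h2.mono le_rfl (by omega) le_rfl (by omega)) (h4 _ (by simp))

theorem body_plug_leaf_le {ds : List (Frame (ℤ × ℤ))} {x₀ x₁ y₀ y₁ : ℤ} {p z : ℤ × ℤ}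
    (h0 : ds ≠ []) (hbox : InBox (plug ds .nil) x₀ x₁ y₀ y₁) (hz : z.2 ≤ y₁) {a : ℝ × ℝ}
    (ha : a ∈ body (plug ds (leaf z))) : a.2 ≤ y₁ := by
  have hzR : (z.2 : ℝ) ≤ y₁ := by exact_mod_cast hz
  rcases body_plug_subset ds (p := p) h0 (root?_leaf z) ha with (h | h) | h
  · exact (hbox a h).2.2.2
  · refine seg_snd_le h ?_ hzR
    exact_mod_cast (hbox.point (lastPos_mem_body h0 p _)).2.2.2
  · rw [body_leaf] at h
    rw [h]
    exact hzR

/-- Adding a vertex with a right subtree above everything else. -/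
theorem good_join_top {x p : ℤ × ℤ} {d S : BinaryTree (ℤ × ℤ)} {x₁ y₁ : ℤ} (hx : x.1 = 0)
    (hbox : InBox d 1 x₁ (x.2 + 1) y₁) (hd : Good x d) (hS : Good x S)
    (hr : ∀ v ∈ root? S, 0 ≤ v.1 ∧ v.2 < x.2) (hb : ∀ a ∈ body S, a.2 < x.2)
    (hp : (p.1 ≤ 0 ∧ x.2 < p.2) ∨ (p.1 < 0 ∧ ∀ a ∈ body S, 0 ≤ a.1)) :
    Good p (join true x d S) := by
  have hstem : ∀ a ∈ stem x d, a = toPlane x ∨ (0 < a.1 ∧ x.2 < a.2) := by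
    intro a ha
    rcases mem_stem.1 ha with ⟨v, hv, ha⟩ | ha
    · obtain ⟨h1, -, h2, -⟩ := hbox.root hv
      by_cases h : a.1 ≤ 0
      · exact Or.inl (eq_left_of_fst_le ha (by omega) (by simpa [hx] using h))
      by_cases h' : a.2 ≤ x.2
      · exact Or.inl (eq_left_of_snd_le ha (by omega) h')
      exact Or.inr ⟨not_le.1 h, not_le.1 h'⟩
    · obtain ⟨h1, -, h2, -⟩ := hbox a ha
      push_cast at h1 h2
      exact Or.inr ⟨by linarith, by linarith⟩
  have hstemS : ∀ a ∈ stem x S, a = toPlane x ∨ a.2 < x.2 := by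
    intro a ha
    rcases mem_stem.1 ha with ⟨v, hv, ha⟩ | ha
    · by_cases h' : (x.2 : ℝ) ≤ a.2
      · exact Or.inl (eq_left_of_le_snd ha (hr v hv).2 h')
      · exact Or.inr (not_le.1 h')
    · exact Or.inr (hb a ha)
  refine good_join.2 ⟨?_, ?_, ?_, ?_, hd, hS⟩
  · rintro rfl; omega
  · intro a ha hab
    rcases hp with ⟨hp1, hp2⟩ | ⟨hp1, hp2⟩
    · have ha1 : a.1 ≤ 0 := seg_fst_le ha (by exact_mod_cast hp1) (by simp [hx])
      have ha2 : (x.2 : ℝ) ≤ a.2 := le_seg_snd ha (by exact_mod_cast hp2.le) le_rfl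
      rcases hab with hab | hab
      · rcases hstem a hab with h | h
        · exact h
        · linarith
      · rcases hstemS a hab with h | h
        · exact h
        · linarith
    · rw [seg_symm] at ha
      refine eq_left_of_le_fst ha (by omega) ?_
      rw [hx]; push_cast
      rcases hab with hab | hab
      · rcases hstem a hab with rfl | h
        · simp [toPlane, hx]
        · exact h.1.le
      · rcases mem_stem.1 hab with ⟨v, hv, h⟩ | h
        · exact le_seg_fst h (by simp [hx]) (by exact_mod_cast (hr v hv).1)
        · exact hp2 a h
  · intro a ha hb'
    rcases hstem a ha with h | h
    · exact h
    · rcases hstemS a hb' with h' | h'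
      · exact h'
      · linarith
  · intro v hv c hc
    obtain ⟨h1, -, h3, -⟩ := hbox.root hv
    obtain ⟨h5, h6⟩ := hr c hc
    have hp' : (p.1 ≤ 0 ∧ x.2 < p.2) ∨ p.1 < 0 := hp.imp_right And.left
    obtain ⟨x0, x1⟩ := x
    obtain ⟨v0, v1⟩ := v
    obtain ⟨c0, c1⟩ := c
    obtain ⟨p0, p1⟩ := p
    simp only at hx h1 h3 h5 h6 hp'
    subst hx
    simp only [cond_true, Ccw, cr, sub_zero]
    have e1 : 0 < c0 * (v1 - x1) - (c1 - x1) * v0 := by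
      nlinarith [mul_nonneg h5 (show 0 ≤ v1 - x1 by omega),
        mul_pos (show 0 < x1 - c1 by omega) (show 0 < v0 by omega)]
    by_cases hp1 : x1 ≤ p1
    · refine Or.inr (Or.inl ⟨e1, ?_⟩)
      rcases hp' with h | h
      · nlinarith [mul_pos (show 0 < v0 by omega) (show 0 < p1 - x1 by omega),
          mul_nonneg (show 0 ≤ v1 - x1 by omega) (neg_nonneg.2 h.1)]
      · nlinarith [mul_nonneg (show 0 ≤ v0 by omega) (show 0 ≤ p1 - x1 by omega),
          mul_pos (show 0 < v1 - x1 by omega) (neg_pos.2 h)]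
    · have h : p0 < 0 := by omega
      refine Or.inl ⟨?_, e1⟩
      nlinarith [mul_pos (neg_pos.2 h) (show 0 < x1 - c1 by omega),
        mul_nonneg (show 0 ≤ x1 - p1 by omega) h5]

/-- Common core of stacking and of the two-vertex spine: the new vertex goes to `(0, X)`, its
subtree to the upper right of it, and the rest below, where it has already been checked with `(0,
X)` as parent. -/
theorem spineDraw_cons_of_good {t : BinaryTree Unit} {w h W X : ℤ} {ds : List (Frame (ℤ × ℤ))}
    (hds : ds ≠ []) (hX : 0 < X) (hh : 0 ≤ h) (ht : TreeDraw t w h) (hw : w + 1 ≤ W) (hW : 0 ≤ W)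
    (hbox : InBox (plug ds .nil) 0 W 0 (X - 1)) (hlast : ∀ p, (lastPos p ds).2 = 0)
    (hgood : ∀ z : ℤ × ℤ, z.2 ≤ 0 → z ≠ lastPos (0, X) ds → Good (0, X) (plug ds (leaf z))) :
    SpineDraw ((true, (), t) :: ds.map shapeF) W (X + 1 + h) := by
  obtain ⟨d, rfl, hd1, -, hd2⟩ := ht.left 1 (X + 1)
  have hdX := hd2 (0, X) (by simp)
  have hroot : ∀ e, ∀ v ∈ root? (plug ds e), 0 ≤ v.1 ∧ v.2 < X := by
    intro e v hv
    have : v ∈ root? (plug ds .nil) := by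
      cases ds with
      | nil => exact absurd rfl hds
      | cons f ds => simpa using hv
    obtain ⟨h1, -, -, h2⟩ := hbox.root this
    omega
  refine ⟨(true, (0, X), d) :: ds, rfl, by simp, ?_, by simp, fun p => hlast _, ?_, ?_⟩
  · intro a ha
    have hWR : (0 : ℝ) ≤ W := by exact_mod_cast hW
    have hXR : (0 : ℝ) < X := by exact_mod_cast hX
    have hhR : (0 : ℝ) ≤ h := by exact_mod_cast hh
    have hwR : (w : ℝ) + 1 ≤ W := by exact_mod_cast hw
    simp only [plug_cons, body_join] at ha
    push_cast
    rcases ha with rfl | ha | ha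
    · simp only [toPlane]; push_cast
      refine ⟨?_, ?_, ?_, ?_⟩ <;> linarith
    · rcases mem_stem.1 ha with ⟨v, hv, ha⟩ | ha
      · have := hd1 _ (root_mem_body hv)
        simp only [toPlane] at this
        push_cast at this
        refine ⟨le_seg_fst ha ?_ ?_, seg_fst_le ha ?_ ?_, le_seg_snd ha ?_ ?_,
          seg_snd_le ha ?_ ?_⟩ <;> push_cast <;> linarith
      · have := hd1 _ ha
        push_cast at this
        refine ⟨?_, ?_, ?_, ?_⟩ <;> linarith
    · rcases mem_stem.1 ha with ⟨v, hv, ha⟩ | ha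
      · have := hbox _ (root_mem_body hv)
        simp only [toPlane] at this
        push_cast at this
        refine ⟨le_seg_fst ha ?_ ?_, seg_fst_le ha ?_ ?_, le_seg_snd ha ?_ ?_,
          seg_snd_le ha ?_ ?_⟩ <;> push_cast <;> linarith
      · have := hbox _ ha
        push_cast at this
        refine ⟨?_, ?_, ?_, ?_⟩ <;> linarith
  · intro p z hp hp' hz hzq
    refine good_join_top rfl hd1 hdX (hgood z hz hzq) (hroot _) ?_ (Or.inl ⟨hp, by simp; omega⟩)
    intro a ha
    have := body_plug_leaf_le (p := (0, X)) hds hbox (by omega) ha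
    push_cast at this
    simp only
    linarith
  · intro p hp
    have hg := hgood ((lastPos (0, X) ds).1, -1) (by simp) (by
      intro h
      have := hlast (0, X)
      rw [← h] at this
      simp at this)
    refine good_join_top rfl hd1 hdX (good_plug_nil hg) (hroot _) ?_ (Or.inr ⟨hp, ?_⟩)
    · intro a ha
      have := (hbox a ha).2.2.2
      push_cast at this
      simp only
      linarith
    · intro a ha
      have := (hbox a ha).1
      push_cast at this
      exact this

/-- Stacking a vertex with a right subtree on top of a spine. -/
theorem SpineDraw.cons {t : BinaryTree Unit} {s : List (Frame Unit)} {w h W H : ℤ} (hH : 0 ≤ H)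
    (hh : 0 ≤ h) (hW : 0 ≤ W) (ht : TreeDraw t w h) (hw : w + 1 ≤ W) (hs : SpineDraw s W H) :
    SpineDraw ((true, (), t) :: s) W (H + h + 2) := by
  obtain ⟨ds, rfl, h2, h3, h4, h5, h6, h7⟩ := hs
  have := spineDraw_cons_of_good (X := H + 1) h2 (by omega) hh ht hw hW (by simpa using h3) h5
    (fun z hz hzq => h6 _ z (by simp) (by simp) hz hzq)
  exact this.mono le_rfl (by omega)

/-- A spine with two vertices that have a right and a left subtree, respectively. -/
theorem spineDraw_pair {t₁ t₂ : BinaryTree Unit} {w h₁ h₂ : ℤ} (hw : 0 ≤ w) (hh₁ : 0 ≤ h₁)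
    (hh₂ : 0 ≤ h₂) (ht₁ : TreeDraw t₁ w h₁) (ht₂ : TreeDraw (mirror t₂) w h₂) :
    SpineDraw [(true, (), t₁), (false, (), t₂)] (2 * (w + 2)) (2 * (h₂ + 2) + 1 + h₁) := by
  obtain ⟨d, rfl, hd1, hd2, hd3⟩ := ht₂.right 1 1
  -- The path edge from `(0, X)` to `(K, 0)` lies on the line x·X + y·K = K·X. Both (w + 1) / K and
  -- (h₂ + 1) / X are less than 1/2, so the box of the second subtree lies strictly below this line.
  set K : ℤ := 2 * (w + 2) with hK
  set X : ℤ := 2 * (h₂ + 2) with hX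
  have hKX : (w + 1) * X + (h₂ + 1) * K < K * X := by
    rw [hK, hX]; nlinarith
  have hKXR : (w + 1 : ℝ) * X + (h₂ + 1) * K < K * X := by exact_mod_cast hKX
  have hKR : (0 : ℝ) < K := by exact_mod_cast (show 0 < K by omega)
  have hXR : (0 : ℝ) < X := by exact_mod_cast (show 0 < X by omega)
  have hwK : (1 + w : ℝ) < K := by exact_mod_cast (show 1 + w < K by omega)
  have hX1 : (1 : ℝ) ≤ X := by exact_mod_cast (show 1 ≤ X by omega)
  have hhX : (1 + h₂ : ℝ) ≤ X - 1 := by exact_mod_cast (show 1 + h₂ ≤ X - 1 by omega)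
  have hdiag : ∀ a ∈ body d, a.1 * X + a.2 * K < K * X := by
    intro a ha
    obtain ⟨-, e1, -, e2⟩ := hd1 a ha
    push_cast at e1 e2
    nlinarith [mul_le_mul_of_nonneg_right e1 hXR.le, mul_le_mul_of_nonneg_right e2 hKR.le]
  have hstem : ∀ a ∈ stem (K, 0) d, a = toPlane (K, 0) ∨ (a.1 * X + a.2 * K < K * X ∧ 0 < a.2) := by
    intro a ha
    rcases mem_stem.1 ha with ⟨v, hv, ha⟩ | ha
    · have h1 := hdiag _ (root_mem_body hv)
      obtain ⟨-, -, h2, -⟩ := hd1 _ (root_mem_body hv)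
      simp only [toPlane] at h1 h2
      push_cast at h2
      obtain ⟨t, t0, t1, e1, e2⟩ := mem_seg.1 ha
      simp only [Int.cast_zero, zero_add, sub_zero] at e1 e2
      rcases t0.eq_or_lt with rfl | t0
      · left; ext <;> simp [toPlane, e1, e2]
      · right
        rw [e1, e2]
        constructor
        · nlinarith [mul_pos t0 (sub_pos.2 h1)]
        · exact mul_pos t0 (by linarith)
    · right
      refine ⟨hdiag a ha, ?_⟩
      have := (hd1 a ha).2.2.1
      push_cast at this
      linarith
  refine spineDraw_cons_of_good (ds := [(false, (K, 0), d)]) (by simp) (by omega) hh₁ ht₁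
    (by omega) (by omega) ?_ (by simp) ?_
  · intro a ha
    simp only [plug_cons, plug_nil, body_join, stem_nil, Set.union_empty] at ha
    push_cast
    rcases ha with rfl | ha
    · simp only [toPlane]; push_cast
      refine ⟨?_, ?_, ?_, ?_⟩ <;> linarith
    · rcases mem_stem.1 ha with ⟨v, hv, ha⟩ | ha
      · have := hd1 _ (root_mem_body hv)
        simp only [toPlane] at this
        push_cast at this
        refine ⟨le_seg_fst ha ?_ ?_, seg_fst_le ha ?_ ?_, le_seg_snd ha ?_ ?_,
          seg_snd_le ha ?_ ?_⟩ <;> push_cast <;> linarith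
      · have := hd1 _ ha
        push_cast at this
        refine ⟨?_, ?_, ?_, ?_⟩ <;> linarith
  · intro z hz hzq
    simp only [lastPos_cons, lastPos_nil] at hzq
    simp only [plug_cons, plug_nil]
    have hzn : ∀ a ∈ seg (K, 0) z, a.2 ≤ 0 := fun a ha =>
      seg_snd_le ha (by simp) (by exact_mod_cast hz)
    refine good_join.2 ⟨?_, ?_, ?_, ?_, hd3 _ (by simp; omega), good_leaf.2 hzq.symm⟩
    · simp; omega
    · rintro a ha (hb | hb)
      · rcases hstem a hb with h | h
        · exact h
        · obtain ⟨t, t0, t1, e1, e2⟩ := mem_seg.1 ha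
          simp only [Int.cast_zero, zero_add, sub_zero, zero_sub] at e1 e2
          have : a.1 * X + a.2 * K = K * X := by rw [e1, e2]; ring
          linarith
      · rw [mem_stem_leaf] at hb
        rw [seg_symm] at ha
        exact eq_left_of_snd_le ha (by simp; omega) (by simpa using hzn a hb)
    · intro a ha hb
      rw [mem_stem_leaf] at hb
      rcases hstem a ha with h | h
      · exact h
      · linarith [hzn a hb]
    · intro v hv c hc
      simp only [root?_leaf, Option.mem_def, Option.some.injEq] at hc
      subst hc
      have h1 := hdiag _ (root_mem_body hv)
      obtain ⟨-, h2, h3, -⟩ := hd1.root hv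
      simp only [toPlane] at h1
      have h1' : v.1 * X + v.2 * K < K * X := by exact_mod_cast h1
      obtain ⟨x, y⟩ := v
      obtain ⟨z, q⟩ := z
      simp only [cond_false, Ccw, cr, sub_zero, zero_sub] at *
      have hK0 : 0 < K := by omega
      have hX0 : 0 < X := by omega
      have e1 : 0 < -K * y - X * (x - K) := by nlinarith
      -- If the turn from the subtree to the continuation is not less than a half turn, the
      -- continuation must leave to the right. The turn from it back to `(0, X)` is then less than a
      -- half turn.
      by_cases hc : 0 < (x - K) * q - y * (z - K)
      · exact Or.inl ⟨e1, hc⟩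
      · refine Or.inr (Or.inr ⟨?_, e1⟩)
        have hu : 0 < K - x := by omega
        have hy : 0 < y := by omega
        push Not at hc
        have hzK : 0 < z - K := by
          by_contra hcon
          push Not at hcon
          rcases hcon.eq_or_lt with h0 | h0
          · have : q ≠ 0 := by rintro rfl; exact hzq (by ext <;> simp; omega)
            have : q < 0 := lt_of_le_of_ne hz this
            nlinarith [mul_pos hu (neg_pos.2 this)]
          · nlinarith [mul_nonneg hu.le (neg_nonneg.2 hz), mul_pos hy (neg_pos.2 h0)]
        have h5 : (K - x) * (K * (-q)) < (K - x) * (X * (z - K)) := by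
          nlinarith [mul_le_mul_of_nonneg_left hc hK0.le, mul_pos hzK e1]
        have := lt_of_mul_lt_mul_left h5 hu.le
        nlinarith

/-- A tree, drawn lying on its side. -/
theorem treeDraw_rotated {l r : BinaryTree Unit} {w h : ℤ} (hw : 0 ≤ w) (hh : 0 ≤ h)
    (hl : TreeDraw l w h) (hr : TreeDraw r w h) :
    TreeDraw (.node () l r) (2 * h + 2) (w + 1) := by
  -- Both turned subtrees stand on the line of height 1, the left one farther to the right: turning
  -- counterclockwise from a parent on the left, one meets it first. The doubling thus affects the
  -- width only.
  obtain ⟨dl, rfl, l1, l2, l3⟩ := hl.below (h + 2) 1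
  obtain ⟨dr, rfl, r1, r2, r3⟩ := hr.below 1 1
  have hwR : (0 : ℝ) ≤ w := by exact_mod_cast hw
  have hhR : (0 : ℝ) ≤ h := by exact_mod_cast hh
  have hbox : InBox (.node (0, 0) dl dr) 0 (2 * h + 2) 0 (w + 1) := by
    intro a ha
    rw [body_node] at ha
    push_cast
    rcases ha with rfl | ha | ha
    · simp only [toPlane]; push_cast
      refine ⟨?_, ?_, ?_, ?_⟩ <;> linarith
    · rcases mem_stem.1 ha with ⟨v, hv, ha⟩ | ha
      · have := l1 _ (root_mem_body hv)
        simp only [toPlane] at this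
        push_cast at this
        refine ⟨le_seg_fst ha ?_ ?_, seg_fst_le ha ?_ ?_, le_seg_snd ha ?_ ?_,
          seg_snd_le ha ?_ ?_⟩ <;> push_cast <;> linarith
      · have := l1 _ ha
        push_cast at this
        refine ⟨?_, ?_, ?_, ?_⟩ <;> linarith
    · rcases mem_stem.1 ha with ⟨v, hv, ha⟩ | ha
      · have := r1 _ (root_mem_body hv)
        simp only [toPlane] at this
        push_cast at this
        refine ⟨le_seg_fst ha ?_ ?_, seg_fst_le ha ?_ ?_, le_seg_snd ha ?_ ?_,
          seg_snd_le ha ?_ ?_⟩ <;> push_cast <;> linarith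
      · have := r1 _ ha
        push_cast at this
        refine ⟨?_, ?_, ?_, ?_⟩ <;> linarith
  have hedge : ∀ {d : BinaryTree (ℤ × ℤ)} {v : ℤ × ℤ} {a : ℝ × ℝ}, v ∈ root? d → v.2 = 1 →
      a ∈ seg (0, 0) v → a.1 = a.2 * v.1 ∧ a.2 ≤ 1 := by
    intro d v a hv hv1 ha
    obtain ⟨t, t0, t1, e1, e2⟩ := mem_seg.1 ha
    rw [hv1] at e2
    simp only [Int.cast_zero, Int.cast_one, zero_add, sub_zero, mul_one] at e1 e2
    rw [e1, e2]
    exact ⟨rfl, t1⟩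
  refine ⟨.node (0, 0) dl dr, rfl, hbox, by simp, fun p hp => ⟨?_, ?_, ?_, ?_, l3 _ (by simp),
    r3 _ (by simp)⟩⟩
  · rintro rfl; simp at hp
  · intro a ha hb
    rw [seg_symm] at ha
    refine eq_left_of_le_fst ha (by simpa) ?_
    have := (hbox a (by rw [body_node]; exact Or.inr hb)).1
    exact this
  · intro a ha hb
    rcases mem_stem.1 ha with ⟨v, hv, ha⟩ | ha <;> rcases mem_stem.1 hb with ⟨u, hu, hb⟩ | hb
    · obtain ⟨e1, -⟩ := hedge hv (l2 v hv) ha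
      obtain ⟨e2, -⟩ := hedge hu (r2 u hu) hb
      have h1 := (l1.root hv).1
      have h2 := (r1.root hu).2.1
      have h3 : (u.1 : ℝ) < v.1 := by exact_mod_cast (show u.1 < v.1 by omega)
      have h4 : a.2 = 0 := by
        rw [e1] at e2
        rcases mul_eq_mul_left_iff.1 e2 with h | h
        · linarith
        · exact h
      ext <;> simp [toPlane, e1, h4]
    · obtain ⟨e1, e3⟩ := hedge hv (l2 v hv) ha
      obtain ⟨-, h2, h3, -⟩ := r1 a hb
      have h1 : ((h : ℝ) + 2) ≤ v.1 := by exact_mod_cast (l1.root hv).1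
      push_cast at h2 h3
      have : a.2 = 1 := le_antisymm e3 h3
      rw [this, one_mul] at e1
      linarith
    · obtain ⟨e1, e3⟩ := hedge hu (r2 u hu) hb
      obtain ⟨h2, -, h3, -⟩ := l1 a ha
      have h1 : (u.1 : ℝ) ≤ 1 + h := by exact_mod_cast (r1.root hu).2.1
      push_cast at h2 h3
      have : a.2 = 1 := le_antisymm e3 h3
      rw [this, one_mul] at e1
      linarith
    · have h1 := (l1 a ha).1
      have h2 := (r1 a hb).2.1
      push_cast at h1 h2
      linarith
  · intro v hv u hu
    have h1 := (l1.root hv).1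
    have h2 := (r1.root hu).2.1
    have h3 := (r1.root hu).1
    have h4 := l2 v hv
    have h5 := r2 u hu
    obtain ⟨v0, v1⟩ := v
    obtain ⟨u0, u1⟩ := u
    obtain ⟨p0, p1⟩ := p
    simp only at h1 h2 h3 h4 h5 hp
    subst h4 h5
    simp only [Ccw, cr, sub_zero, mul_one, one_mul]
    have e1 : 0 < v0 - u0 := by omega
    by_cases hc : 0 < u0 * p1 - p0
    · exact Or.inr (Or.inl ⟨e1, hc⟩)
    · refine Or.inl ⟨?_, e1⟩
      push Not at hc
      have : p1 < 0 := by
        by_contra hcon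
        push Not at hcon
        nlinarith [mul_nonneg (show 0 ≤ u0 by omega) hcon]
      nlinarith [mul_pos e1 (neg_pos.2 this)]

-- Crossing spines and the gluing step

theorem root?_plug_of_ne {ds : List (Frame (ℤ × ℤ))} (h : ds ≠ []) (e e' : BinaryTree (ℤ × ℤ)) :
    root? (plug ds e) = root? (plug ds e') := by
  cases ds with
  | nil => exact absurd rfl h
  | cons f ds => simp

/-- A spine drawn lying on its side, in a box with right side `W` and lower side `r`: entered from
the left at height `ρ`, and left at the right side, where only the last vertex lies. -/
def Crossing (u : List (Frame Unit)) (w h : ℤ) : Prop :=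
  ∀ W r : ℤ, ∃ (ds : List (Frame (ℤ × ℤ))) (ρ : ℤ), ds.map shapeF = u ∧ ds ≠ [] ∧
    InBox (plug ds .nil) (W - w) W r (r + h) ∧ r ≤ ρ ∧ ρ ≤ r + h ∧
    (∀ v ∈ root? (plug ds .nil), v.2 = ρ) ∧ (∀ p, (lastPos p ds).1 = W) ∧
    ∀ p z : ℤ × ℤ, p.1 < W - w → p.2 = ρ → W ≤ z.1 → z ≠ lastPos p ds →
      Good p (plug ds (leaf z))

/-- A quarter turn takes the lower side to the right side and lets the spine be entered at the lower
edge of the box. If only the mirror image is drawn, reflection in a line of slope -1 does the same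
with the entrance at the upper edge. This is why `Crossing` leaves `ρ` open. -/
theorem SpineDraw.crossing {u : List (Frame Unit)} {w h : ℤ} (hw : 0 ≤ w)
    (hu : SpineDraw u w h ∨ SpineDraw (u.map mirrorF) w h) : Crossing u h w := by
  intro W r
  rcases hu with ⟨ds, h1, h2, h3, h4, h5, h6, -⟩ | ⟨ds, h1, h2, h3, h4, h5, h6, -⟩
  · refine ⟨ds.map (relabelF false (aff 0 (-1) 1 0 W r)), r, ?_, by simpa, ?_, le_rfl, by omega,
      ?_, ?_, ?_⟩
    · rw [map_shapeF_map_relabelF]; exact h1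
    · rw [← relabel_nil false (aff 0 (-1) 1 0 W r), ← relabel_plug]
      refine InBox.relabel fun a ha => ?_
      have := h3 a ha
      push_cast at *
      refine ⟨?_, ?_, ?_, ?_⟩ <;> linarith
    · rw [← relabel_nil false (aff 0 (-1) 1 0 W r), ← relabel_plug]
      intro v hv
      rw [root?_relabel, Option.mem_map] at hv
      obtain ⟨v, hv, rfl⟩ := hv
      simp [aff, h4 v hv]
    · intro p
      rw [lastPos_of_ne (by simpa) p (aff 0 (-1) 1 0 W r p), lastPos_map]
      simp [aff, h5 p]
    · intro p z hp hp' hz hzq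
      have hp2 : p = aff 0 (-1) 1 0 W r (p.2 - r, W - p.1) := by simp [aff]
      have hz2 : z = aff 0 (-1) 1 0 W r (z.2 - r, W - z.1) := by simp [aff]
      rw [hp2, hz2, lastPos_map] at hzq
      rw [hp2, hz2, ← relabel_leaf false, ← relabel_plug]
      exact good_relabel (by simp)
        (h6 _ _ (by simp; omega) (by simp; omega) (by simp; omega) fun hh => hzq (by rw [hh]))
  · refine ⟨ds.map (relabelF true (aff 0 (-1) (-1) 0 W (r + w))), r + w, ?_, by simpa, ?_,
      by omega, le_rfl, ?_, ?_, ?_⟩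
    · rw [map_shapeF_map_relabelF, h1]; exact map_mirrorF_map_mirrorF _
    · rw [← relabel_nil true (aff 0 (-1) (-1) 0 W (r + w)), ← relabel_plug]
      refine InBox.relabel fun a ha => ?_
      have := h3 a ha
      push_cast at *
      refine ⟨?_, ?_, ?_, ?_⟩ <;> linarith
    · rw [← relabel_nil true (aff 0 (-1) (-1) 0 W (r + w)), ← relabel_plug]
      intro v hv
      rw [root?_relabel, Option.mem_map] at hv
      obtain ⟨v, hv, rfl⟩ := hv
      simp [aff, h4 v hv]
    · intro p
      rw [lastPos_of_ne (by simpa) p (aff 0 (-1) (-1) 0 W (r + w) p), lastPos_map]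
      simp [aff, h5 p]
    · intro p z hp hp' hz hzq
      have hp2 : p = aff 0 (-1) (-1) 0 W (r + w) (r + w - p.2, W - p.1) := by simp [aff]
      have hz2 : z = aff 0 (-1) (-1) 0 W (r + w) (r + w - z.2, W - z.1) := by simp [aff]
      rw [hp2, hz2, lastPos_map] at hzq
      rw [hp2, hz2, ← relabel_leaf true, ← relabel_plug]
      exact good_relabel (by simp)
        (h6 _ _ (by simp; omega) (by simp; omega) (by simp; omega) fun hh => hzq (by rw [hh]))

/-- A drawing of the mirror image of a spine, reflected at a vertical line. -/
theorem SpineDraw.reflect {s : List (Frame Unit)} {W H : ℤ} (hs : SpineDraw (s.map mirrorF) W H) :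
    ∃ ds : List (Frame (ℤ × ℤ)), ds.map shapeF = s ∧ ds ≠ [] ∧ InBox (plug ds .nil) 0 W 0 H ∧
    (∀ v ∈ root? (plug ds .nil), v.1 = W) ∧ (∀ p, (lastPos p ds).2 = 0) ∧
    (∀ p z : ℤ × ℤ, W ≤ p.1 → H < p.2 → z.2 ≤ 0 → z ≠ lastPos p ds →
      Good p (plug ds (leaf z))) := by
  obtain ⟨ds, h1, h2, h3, h4, h5, h6, -⟩ := hs
  refine ⟨ds.map (relabelF true (aff (-1) 0 0 1 W 0)), ?_, by simpa, ?_, ?_, ?_, ?_⟩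
  · rw [map_shapeF_map_relabelF, h1]; exact map_mirrorF_map_mirrorF _
  · rw [← relabel_nil true (aff (-1) 0 0 1 W 0), ← relabel_plug]
    refine InBox.relabel fun a ha => ?_
    have := h3 a ha
    push_cast at *
    refine ⟨?_, ?_, ?_, ?_⟩ <;> linarith
  · rw [← relabel_nil true (aff (-1) 0 0 1 W 0), ← relabel_plug]
    intro v hv
    rw [root?_relabel, Option.mem_map] at hv
    obtain ⟨v, hv, rfl⟩ := hv
    simp [aff, h4 v hv]
  · intro p
    rw [lastPos_of_ne (by simpa) p (aff (-1) 0 0 1 W 0 p), lastPos_map]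
    simp [aff, h5 p]
  · intro p z hp hp' hz hzq
    have hp2 : p = aff (-1) 0 0 1 W 0 (W - p.1, p.2) := by simp [aff]
    have hz2 : z = aff (-1) 0 0 1 W 0 (W - z.1, z.2) := by simp [aff]
    rw [hp2, hz2, lastPos_map] at hzq
    rw [hp2, hz2, ← relabel_leaf true, ← relabel_plug]
    exact good_relabel (by simp)
      (h6 _ _ (by simp; omega) (by simp; omega) (by simp; omega) fun hh => hzq (by rw [hh]))

/-- The points covered by a crossing spine, with its entering edge, and what follows it. -/
theorem mem_stem_plug_cases {ds : List (Frame (ℤ × ℤ))} {D : BinaryTree (ℤ × ℤ)} {x z : ℤ × ℤ}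
    {x₀ W r r₁ : ℤ} (hds : ds ≠ []) (hbox : InBox (plug ds .nil) x₀ W r r₁)
    (hroot : ∀ v ∈ root? (plug ds .nil), v.2 = x.2) (hx : x.1 < x₀)
    (hlast : (lastPos x ds).1 = W) (hz : root? D = some z) (hzW : z.1 = W) (hzr : z.2 ≤ r)
    {a : ℝ × ℝ} (ha : a ∈ stem x (plug ds D)) :
    (a = toPlane x ∨ (a.2 = x.2 ∧ (x.1 : ℝ) < a.1 ∧ a.1 ≤ W)) ∨
      ((x₀ : ℝ) ≤ a.1 ∧ a.1 ≤ W ∧ (r : ℝ) ≤ a.2 ∧ a.2 ≤ r₁) ∨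
      (a.1 = W ∧ (z.2 : ℝ) ≤ a.2 ∧ a.2 ≤ r₁) ∨ a ∈ body D := by
  rcases mem_stem.1 ha with ⟨v, hv, ha⟩ | ha
  · rw [root?_plug_of_ne hds D .nil] at hv
    have h1 := hroot v hv
    obtain ⟨h2, h3, -, -⟩ := hbox.root hv
    left
    by_cases h : a.1 ≤ x.1
    · exact Or.inl (eq_left_of_fst_le ha (by omega) h)
    · refine Or.inr ⟨le_antisymm ?_ ?_, not_le.1 h, ?_⟩
      · exact seg_snd_le ha le_rfl (by rw [h1])
      · exact le_seg_snd ha le_rfl (by rw [h1])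
      · refine seg_fst_le ha ?_ ?_
        · exact_mod_cast (show x.1 ≤ W by omega)
        · exact_mod_cast h3
  · right
    rcases body_plug_subset ds (p := x) hds hz ha with (h | h) | h
    · exact Or.inl (hbox a h)
    · right; left
      have hq := hbox.point (lastPos_mem_body hds x _)
      refine ⟨le_antisymm (seg_fst_le h (by rw [hlast]) (by rw [hzW]))
        (le_seg_fst h (by rw [hlast]) (by rw [hzW])), le_seg_snd h ?_ le_rfl, seg_snd_le h ?_ ?_⟩
      · exact_mod_cast hzr.trans hq.2.2.1
      · exact_mod_cast hq.2.2.2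
      · exact_mod_cast hzr.trans (hq.2.2.1.trans hq.2.2.2)
    · exact Or.inr (Or.inr h)

/-- Turning counterclockwise from a parent above or on the left, one meets first what lies below the
horizontal edge to the crossing. Hence left subtrees go below the crossing and, by `ccw_above`,
right ones above it. -/
theorem ccw_below {c₀ c₁ v p₀ p₁ : ℤ} (hc : 0 < c₀) (hk : v < c₁)
    (hp : (p₀ ≤ 0 ∧ c₁ < p₁) ∨ p₀ < 0) : Ccw (0, c₁) (p₀, p₁) (1, v) (c₀, c₁) := by
  simp only [Ccw, cr, sub_zero, sub_self, mul_zero, mul_one, zero_sub]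
  have e1 : 0 < -((v - c₁) * c₀) := by nlinarith [mul_pos (sub_pos.2 hk) hc]
  by_cases hp1 : c₁ < p₁
  · exact Or.inr (Or.inl ⟨e1, by nlinarith [mul_pos hc (sub_pos.2 hp1)]⟩)
  · have h : p₀ < 0 := by omega
    exact Or.inl ⟨by nlinarith [mul_pos (sub_pos.2 hk) (neg_pos.2 h)], e1⟩

theorem ccw_above {c₀ c₁ v p₀ p₁ : ℤ} (hc : 0 < c₀) (hk : c₁ < v)
    (hp : (p₀ ≤ 0 ∧ c₁ < p₁) ∨ p₀ < 0) : Ccw (0, c₁) (p₀, p₁) (c₀, c₁) (1, v) := by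
  simp only [Ccw, cr, sub_zero, sub_self, mul_zero, one_mul, mul_one, zero_sub]
  have e1 : 0 < c₀ * (v - c₁) := mul_pos hc (sub_pos.2 hk)
  by_cases hp1 : c₁ ≤ p₁
  · refine Or.inr (Or.inl ⟨by linarith, ?_⟩)
    rcases hp with h | h
    · nlinarith [mul_nonneg (sub_pos.2 hk).le (neg_nonneg.2 h.1)]
    · nlinarith [mul_pos (sub_pos.2 hk) (neg_pos.2 h)]
  · refine Or.inl ⟨?_, by linarith⟩
    nlinarith [mul_pos hc (show 0 < c₁ - p₁ by omega)]

/-- Gluing a vertex `x` on the left side, the subtree `d` hanging off it, a crossing spine `du`,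
and the drawing `D` of the rest below all these. -/
theorem good_join_crossing {b : Bool} {p x : ℤ × ℤ} {d D : BinaryTree (ℤ × ℤ)}
    {du : List (Frame (ℤ × ℤ))} {z : ℤ × ℤ} {x₀ W r r₁ l l₁ w H : ℤ} (hx : x.1 = 0)
    (hdbox : InBox d 1 w l l₁) (hdroot : ∀ v ∈ root? d, v.1 = 1) (hd : Good x d)
    (hdu : du ≠ []) (hubox : InBox (plug du .nil) x₀ W r r₁)
    (huroot : ∀ v ∈ root? (plug du .nil), v.2 = x.2) (hx₀ : 0 < x₀) (hrx : r ≤ x.2)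
    (hxr : x.2 ≤ r₁) (hulast : (lastPos x du).1 = W) (hu : Good x (plug du (leaf z)))
    (hz : root? D = some z) (hzW : z.1 = W) (hDH : ∀ a ∈ body D, a.2 ≤ H)
    (hD : Good (lastPos x du) D) (hr : H < r) (hl : H < l) (hw : w < W)
    (hb : (b = false ∧ l₁ < r) ∨ (b = true ∧ r₁ < l))
    (hp : (p.1 ≤ 0 ∧ x.2 < p.2) ∨ (p.1 < 0 ∧ ∀ a ∈ body D, 0 ≤ a.1)) :
    Good p (join b x d (plug du D)) := by
  have hzH : z.2 ≤ H := by
    have := hDH _ (root_mem_body hz)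
    simpa [toPlane] using this
  have cast1 : (0 : ℝ) < x₀ := by exact_mod_cast hx₀
  have cast2 : (r : ℝ) ≤ x.2 := by exact_mod_cast hrx
  have cast3 : (x.2 : ℝ) ≤ r₁ := by exact_mod_cast hxr
  have cast4 : (H : ℝ) < r := by exact_mod_cast hr
  have cast5 : (H : ℝ) < l := by exact_mod_cast hl
  have cast6 : (w : ℝ) < W := by exact_mod_cast hw
  have castb : ((l₁ : ℝ) < r) ∨ ((r₁ : ℝ) < l) :=
    hb.imp (fun h => by exact_mod_cast h.2) fun h => by exact_mod_cast h.2
  obtain ⟨u0, hu0⟩ : ∃ u0, u0 ∈ root? (plug du .nil) := by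
    cases du with
    | nil => exact absurd rfl hdu
    | cons f du => exact ⟨f.2.1, by simp⟩
  obtain ⟨hu1, hu2, -, -⟩ := hubox.root hu0
  have cast7 : (0 : ℝ) < W := by exact_mod_cast (show 0 < W by omega)
  have hspine : ∀ a ∈ stem x (plug du D), (a = toPlane x ∨ (a.2 = x.2 ∧ 0 < a.1)) ∨
      (x₀ ≤ a.1 ∧ r ≤ a.2 ∧ a.2 ≤ r₁) ∨ a.1 = W ∨ a ∈ body D := by
    intro a ha
    have := mem_stem_plug_cases hdu hubox huroot (by omega) hulast hz hzW (by omega) ha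
    rw [hx] at this
    push_cast at this
    tauto
  have hspine0 : ∀ a ∈ stem x (plug du .nil), r ≤ a.2 := by
    intro a ha
    rcases mem_stem.1 ha with ⟨v, hv, ha⟩ | ha
    · exact le_seg_snd ha cast2 (by rw [huroot v hv]; exact cast2)
    · exact (hubox a ha).2.2.1
  have hU : Good x (plug du D) := good_plug hu hz hD fun a ha hab => by
    linarith [hspine0 a ha, hDH a hab]
  -- The edge from `x` to the root of `d` may pass through the heights of the crossing, but only at
  -- abscissas below 1, whereas the crossing begins at `x₀ ≥ 1`. At abscissa 1 the edge has reached
  -- the root, within the heights of `d`.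
  have hstem : ∀ a ∈ stem x d, a = toPlane x ∨ (0 < a.1 ∧ a.1 < W ∧ H < a.2 ∧ a.2 ≠ x.2 ∧
      (a.1 < x₀ ∧ (a.1 < 1 ∨ (l ≤ a.2 ∧ a.2 ≤ l₁)) ∨ (l ≤ a.2 ∧ a.2 ≤ l₁))) := by
    intro a ha
    have hx0R : (1 : ℝ) ≤ x₀ := by exact_mod_cast hx₀
    rcases mem_stem.1 ha with ⟨v, hv, ha⟩ | ha
    · have hv1 := hdroot v hv
      obtain ⟨-, h2, h3, h4⟩ := hdbox.root hv
      by_cases h : a.1 ≤ 0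
      · exact Or.inl (eq_left_of_fst_le ha (by omega) (by simpa [hx] using h))
      right
      have h2' : (v.1 : ℝ) ≤ w := by exact_mod_cast h2
      have ha1 : a.1 ≤ 1 := seg_fst_le ha (by simp [hx]) (by simp [hv1])
      have hw1 : (1 : ℝ) ≤ w := by rw [hv1] at h2'; simpa using h2'
      have h3' : (l : ℝ) ≤ v.2 := by exact_mod_cast h3
      have h4' : (v.2 : ℝ) ≤ l₁ := by exact_mod_cast h4
      refine ⟨not_le.1 h, by linarith, ?_, ?_, ?_⟩
      · have : (H : ℝ) < min (x.2 : ℝ) v.2 := lt_min (by linarith) (by linarith)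
        exact this.trans_le (le_seg_snd ha (min_le_left _ _) (min_le_right _ _))
      · intro hh
        apply h
        have : a = toPlane x := by
          rcases castb with hc | hc
          · refine eq_left_of_le_snd ha ?_ hh.ge
            have : (v.2 : ℝ) < x.2 := by linarith
            exact_mod_cast this
          · refine eq_left_of_snd_le ha ?_ hh.le
            have : (x.2 : ℝ) < v.2 := by linarith
            exact_mod_cast this
        simp [this, toPlane, hx]
      · rcases ha1.lt_or_eq with h1 | h1
        · exact Or.inl ⟨by linarith, Or.inl h1⟩
        · right
          have : a = toPlane v := by
            rw [seg_symm] at ha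
            exact eq_left_of_le_fst ha (by omega) (by simp [hv1, h1])
          rw [this]
          exact ⟨h3', h4'⟩
    · obtain ⟨h1, h2, h3, h4⟩ := hdbox a ha
      push_cast at h1
      refine Or.inr ⟨by linarith, by linarith, by linarith, ?_, Or.inr ⟨h3, h4⟩⟩
      rcases castb with hc | hc
      · exact ne_of_lt (by linarith)
      · exact ne_of_gt (by linarith)
  refine good_join.2 ⟨?_, ?_, ?_, ?_, hd, hU⟩
  · rintro rfl; omega
  · intro a ha hab
    rcases hp with ⟨hp1, hp2⟩ | ⟨hp1, hp2⟩
    · have ha1 : a.1 ≤ 0 := seg_fst_le ha (by exact_mod_cast hp1) (by simp [hx])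
      have ha2 : (x.2 : ℝ) ≤ a.2 := le_seg_snd ha (by exact_mod_cast hp2.le) le_rfl
      rcases hab with hab | hab
      · rcases hstem a hab with h | h
        · exact h
        · linarith [h.1]
      · rcases hspine a hab with (h | h) | h | h | h
        · exact h
        · linarith [h.2]
        · linarith [h.1]
        · linarith
        · linarith [hDH a h]
    · rw [seg_symm] at ha
      refine eq_left_of_le_fst ha (by omega) ?_
      rw [hx]; push_cast
      rcases hab with hab | hab
      · rcases hstem a hab with rfl | h
        · simp [toPlane, hx]
        · exact h.1.le
      · rcases hspine a hab with (rfl | h) | h | h | h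
        · simp [toPlane, hx]
        · exact h.2.le
        · linarith [h.1]
        · linarith
        · exact hp2 a h
  · intro a ha hb'
    rcases hstem a ha with h | ⟨g1, g2, g3, g4, g5⟩
    · exact h
    · exfalso
      rcases hspine a hb' with (h | h) | ⟨h1, h2, h3⟩ | h | h
      · exact g4 (by rw [h]; rfl)
      · exact g4 h.1
      · rcases g5 with ⟨g5, -⟩ | ⟨g5, g6⟩
        · linarith
        · rcases castb with hc | hc <;> linarith
      · linarith
      · linarith [hDH a h]
  · intro v hv c hc
    rw [root?_plug_of_ne hdu D .nil] at hc
    have h1 := hdroot v hv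
    obtain ⟨-, -, h3, h4⟩ := hdbox.root hv
    have h5 := huroot c hc
    obtain ⟨h6, -, -, -⟩ := hubox.root hc
    have hp' : (p.1 ≤ 0 ∧ x.2 < p.2) ∨ p.1 < 0 := hp.imp_right And.left
    obtain ⟨x0, x1⟩ := x
    obtain ⟨v0, v1⟩ := v
    obtain ⟨c0, c1⟩ := c
    obtain ⟨p0, p1⟩ := p
    simp only at hx h1 h3 h4 h5 h6 hp' hrx hxr
    subst hx h1 h5
    rcases hb with ⟨rfl, hb⟩ | ⟨rfl, hb⟩
    · exact ccw_below (by omega) (by omega) hp'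
    · exact ccw_above (by omega) (by omega) hp'

/-- Continuing a spine on top: a vertex with its subtree, followed by a crossing spine. -/
theorem SpineDraw.append {b : Bool} {t : BinaryTree Unit} {u s : List (Frame Unit)}
    {w h wu hu W H : ℤ} (hw : 0 ≤ w) (hh : 0 ≤ h) (hhu : 0 ≤ hu) (hH : 0 ≤ H) (hwu : 0 ≤ wu)
    (ht : TreeDraw t w h) (hcr : Crossing u wu hu) (hs : SpineDraw (s.map mirrorF) W H)
    (hwW : w + 2 ≤ W) (huW : wu + 1 ≤ W) :
    SpineDraw ((b, (), t) :: (u ++ s)) W (H + h + hu + 2) := by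
  obtain ⟨ds, rfl, s2, s3, s4, s5, s6⟩ := hs.reflect
  -- Crossing and subtree are stacked above height `H`, in the order dictated by `b`; the two gaps
  -- between the three layers account for the summand 2.
  obtain ⟨r, l, hrl, hrH, hlH, hrt, hlt⟩ : ∃ r l : ℤ,
      ((b = false ∧ l + h < r) ∨ (b = true ∧ r + hu < l)) ∧ H < r ∧ H < l ∧
      r + hu ≤ H + h + hu + 2 ∧ l + h ≤ H + h + hu + 2 := by
    cases b
    · exact ⟨H + h + 2, H + 1, by simp; omega, by omega, by omega, by omega, by omega⟩
    · exact ⟨H + 1, H + hu + 2, by simp; omega, by omega, by omega, by omega, by omega⟩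
  obtain ⟨du, ρ, rfl, u2, u3, u4, u5, u6, u7, u8⟩ := hcr W r
  obtain ⟨d, rfl, d1, d2, d3⟩ := ht.left 1 l
  have hdx := d3 (0, ρ) (by simp)
  obtain ⟨z, hz⟩ : ∃ z, root? (plug ds .nil) = some z := by
    cases ds with
    | nil => exact absurd rfl s2
    | cons f du => exact ⟨f.2.1, by simp⟩
  have hzW : z.1 = W := s4 z hz
  have hzH := s3.root hz
  have hqu := u3.point (lastPos_mem_body u2 (0, ρ) _)
  have hgu : Good (0, ρ) (plug du (leaf z)) := by
    refine u8 _ _ (by simp; omega) rfl hzW.ge ?_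
    intro hh; rw [← hh] at hqu; omega
  have main : ∀ (p : ℤ × ℤ) (e : BinaryTree (ℤ × ℤ)), Good (lastPos (0, ρ) du) (plug ds e) →
      (∀ a ∈ body (plug ds e), a.2 ≤ H) →
      ((p.1 ≤ 0 ∧ ρ < p.2) ∨ (p.1 < 0 ∧ ∀ a ∈ body (plug ds e), 0 ≤ a.1)) →
      Good p (plug ((b, (0, ρ), d) :: (du ++ ds)) e) := by
    intro p e he heH hp
    rw [plug_cons, plug_append]
    exact good_join_crossing rfl d1 d2 hdx u2 u3 u6 (by omega) u4 u5 (u7 _) hgu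
      (by rw [root?_plug_of_ne s2 e .nil, hz]) hzW heH he hrH hlH (by omega) hrl hp
  have hlast : ∀ p, lastPos p ((b, (0, ρ), d) :: (du ++ ds)) = lastPos (lastPos (0, ρ) du) ds :=
    fun p => by simp [lastPos_append]
  have hsg : ∀ z' : ℤ × ℤ, z'.2 ≤ 0 → z' ≠ lastPos (lastPos (0, ρ) du) ds →
      Good (lastPos (0, ρ) du) (plug ds (leaf z')) := fun z' h1 h2 =>
    s6 _ _ (u7 _).ge (by omega) h1 h2
  refine ⟨(b, (0, ρ), d) :: (du ++ ds), by simp [shapeF, relabelF, shape], by simp, ?_, by simp,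
    fun p => by rw [hlast]; exact s5 _, ?_, ?_⟩
  · have c1 : (0 : ℝ) ≤ w := by exact_mod_cast hw
    have c2 : (0 : ℝ) ≤ h := by exact_mod_cast hh
    have c3 : (0 : ℝ) ≤ hu := by exact_mod_cast hhu
    have c4 : (0 : ℝ) ≤ H := by exact_mod_cast hH
    have c5 : (0 : ℝ) ≤ wu := by exact_mod_cast hwu
    have c6 : (w : ℝ) + 2 ≤ W := by exact_mod_cast hwW
    have c7 : (wu : ℝ) + 1 ≤ W := by exact_mod_cast huW
    have c8 : (H : ℝ) < r := by exact_mod_cast hrH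
    have c9 : (H : ℝ) < l := by exact_mod_cast hlH
    have c10 : (r : ℝ) + hu ≤ H + h + hu + 2 := by exact_mod_cast hrt
    have c11 : (l : ℝ) + h ≤ H + h + hu + 2 := by exact_mod_cast hlt
    have c12 : (r : ℝ) ≤ ρ := by exact_mod_cast u4
    have c13 : (ρ : ℝ) ≤ r + hu := by exact_mod_cast u5
    intro a ha
    simp only [plug_cons, body_join, plug_append] at ha
    push_cast
    rcases ha with rfl | ha | ha
    · simp only [toPlane]; push_cast
      refine ⟨?_, ?_, ?_, ?_⟩ <;> linarith
    · rcases mem_stem.1 ha with ⟨v, hv, ha⟩ | ha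
      · have := d1 _ (root_mem_body hv)
        simp only [toPlane] at this
        push_cast at this
        refine ⟨le_seg_fst ha ?_ ?_, seg_fst_le ha ?_ ?_, le_seg_snd ha ?_ ?_,
          seg_snd_le ha ?_ ?_⟩ <;> push_cast <;> linarith
      · have := d1 _ ha
        push_cast at this
        refine ⟨?_, ?_, ?_, ?_⟩ <;> linarith
    · have c14 : (0 : ℝ) ≤ z.2 := by exact_mod_cast hzH.2.2.1
      have := mem_stem_plug_cases u2 u3 u6 (by simp; omega) (u7 _) hz hzW (by omega) ha
      push_cast at this
      rcases this with (rfl | h) | h | h | h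
      · simp only [toPlane]; push_cast
        refine ⟨?_, ?_, ?_, ?_⟩ <;> linarith
      · obtain ⟨e1, e2, e3⟩ := h
        refine ⟨?_, ?_, ?_, ?_⟩ <;> linarith
      · obtain ⟨e1, e2, e3, e4⟩ := h
        refine ⟨?_, ?_, ?_, ?_⟩ <;> linarith
      · obtain ⟨e1, e2, e3⟩ := h
        refine ⟨?_, ?_, ?_, ?_⟩ <;> linarith
      · have := s3 a h
        push_cast at this
        refine ⟨?_, ?_, ?_, ?_⟩ <;> linarith
  · intro p z' hp hp' hz' hzq
    rw [hlast] at hzq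
    exact main p _ (hsg z' hz' hzq)
      (fun a ha => body_plug_leaf_le (p := (0, 0)) s2 s3 (by omega) ha) (Or.inl ⟨hp, by omega⟩)
  · intro p hp
    have hg := hsg ((lastPos (lastPos (0, ρ) du) ds).1, -1) (by simp) (by
      intro h
      have := s5 (lastPos (0, ρ) du)
      rw [← h] at this
      simp at this)
    exact main p _ (good_plug_nil hg) (fun a ha => (s3 a ha).2.2.2)
      (Or.inr ⟨hp, fun a ha => by simpa using (s3 a ha).1⟩)

/-! ### Spines up to mirroring -/

/-- The spine `s` or its mirror image has a drawing. -/
def SpineDraw' (s : List (Frame Unit)) (W H : ℕ) : Prop :=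
  SpineDraw s W H ∨ SpineDraw (s.map mirrorF) W H

theorem SpineDraw'.mono {s : List (Frame Unit)} {W H W' H' : ℕ} (h : SpineDraw' s W H)
    (hW : W ≤ W') (hH : H ≤ H') : SpineDraw' s W' H' :=
  h.imp (fun h => h.mono (by exact_mod_cast hW) (by exact_mod_cast hH))
    fun h => h.mono (by exact_mod_cast hW) (by exact_mod_cast hH)

theorem spineDraw'_map_mirrorF {s : List (Frame Unit)} {W H : ℕ} :
    SpineDraw' (s.map mirrorF) W H ↔ SpineDraw' s W H := by
  rw [SpineDraw', SpineDraw', map_mirrorF_map_mirrorF, or_comm]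

theorem mirrorF_mk (b : Bool) (t : BinaryTree Unit) :
    mirrorF (b, (), t) = (!b, (), mirror t) := by
  simp [mirrorF, relabelF, mirror]

theorem spineDraw'_singleton {x : Frame Unit} {w h : ℕ} (ht : TreeDraw x.2.2 w h) :
    SpineDraw' [x] (w + 1) (h + 1) := by
  obtain ⟨b, ⟨⟩, t⟩ := x
  cases b
  · right
    simpa [mirrorF_mk] using spineDraw_singleton (by omega) (by omega) ht.mirror
  · left
    simpa using spineDraw_singleton (by omega) (by omega) ht

theorem spineDraw'_singleton_rotated {x : Frame Unit} {w h : ℕ} (ht : TreeDraw x.2.2 w h) :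
    SpineDraw' [x] (h + 1) (w + 1) := by
  obtain ⟨b, ⟨⟩, t⟩ := x
  cases b
  · right
    simpa [mirrorF_mk] using spineDraw_singleton_rotated (by omega) (by omega) ht.mirror
  · left
    simpa using spineDraw_singleton_rotated (by omega) (by omega) ht

/-- After mirroring, the first subtree is on the right. A second one on the same side is handled by
stacking; otherwise the diagonal construction is needed, which doubles the width. -/
theorem spineDraw'_pair {x y : Frame Unit} {w h₁ h₂ : ℕ} (hx : TreeDraw x.2.2 w h₁)
    (hy : TreeDraw y.2.2 w h₂) : SpineDraw' [x, y] (2 * w + 4) (h₁ + 2 * h₂ + 5) := by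
  have key : ∀ (t₁ t₂ : BinaryTree Unit) (b : Bool), TreeDraw t₁ w h₁ → TreeDraw t₂ w h₂ →
      SpineDraw [(true, (), t₁), (b, (), t₂)] (2 * w + 4 : ℕ) (h₁ + 2 * h₂ + 5 : ℕ) := by
    intro t₁ t₂ b ht₁ ht₂
    cases b
    · refine (spineDraw_pair (by omega) (by omega) (by omega) ht₁ ht₂.mirror).mono ?_ ?_ <;>
        push_cast <;> linarith
    · refine (SpineDraw.cons (by omega) (by omega) (by omega) ht₁ le_rfl
        (spineDraw_singleton (by omega) (by omega) ht₂)).mono ?_ ?_ <;> push_cast <;> linarith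
  obtain ⟨b, ⟨⟩, t₁⟩ := x
  obtain ⟨c, ⟨⟩, t₂⟩ := y
  cases b
  · right
    simpa [mirrorF_mk] using key _ _ (!c) hx.mirror hy.mirror
  · left
    exact key _ _ c hx hy

/-- The gluing step consumes a drawing of the mirrored rest. If the rest itself is drawn instead,
the mirror image of the whole spine is built. Working up to mirroring thus costs nothing. -/
theorem SpineDraw'.append {x : Frame Unit} {u s : List (Frame Unit)} {w h wu hu W H : ℕ}
    (ht : TreeDraw x.2.2 w h) (hcr : SpineDraw' u hu wu) (hs : SpineDraw' s W H)
    (hwW : w + 2 ≤ W) (huW : wu + 1 ≤ W) :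
    SpineDraw' (x :: (u ++ s)) W (H + h + hu + 2) := by
  obtain ⟨b, ⟨⟩, t⟩ := x
  have key : ∀ (b : Bool) (t : BinaryTree Unit) (u s : List (Frame Unit)), TreeDraw t w h →
      SpineDraw' u hu wu → SpineDraw (s.map mirrorF) W H →
      SpineDraw ((b, (), t) :: (u ++ s)) W (H + h + hu + 2 : ℕ) := by
    intro b t u s ht hcr hs
    push_cast
    exact SpineDraw.append (by omega) (by omega) (by omega) (by omega) (by omega) ht
      (SpineDraw.crossing (by omega) hcr) hs (by omega) (by omega)
  rcases hs with hs | hs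
  · right
    rw [List.map_cons, List.map_append, mirrorF_mk]
    exact key _ _ _ _ ht.mirror (spineDraw'_map_mirrorF.2 hcr) (by rwa [map_mirrorF_map_mirrorF])
  · left
    exact key b t u s ht hcr hs

theorem body_plug_nil_subset (ds : List (Frame (ℤ × ℤ))) (e : BinaryTree (ℤ × ℤ)) :
    body (plug ds .nil) ⊆ body (plug ds e) := by
  cases ds with
  | nil => simp
  | cons f ds =>
    intro a ha
    simp only [plug_cons, body_join, Set.mem_union] at ha ⊢
    have := @stem_plug_nil_subset f.2.1 ds e a
    tauto

/-- Removing an auxiliary last vertex from a spine. -/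
theorem SpineDraw'.treeDraw_of_append {s : List (Frame Unit)} {b : Bool} {W H : ℕ}
    (h : SpineDraw' (s ++ [(b, (), .nil)]) W H) : TreeDraw (plug s .nil) W H := by
  have key : ∀ (s : List (Frame Unit)) (b : Bool), SpineDraw (s ++ [(b, (), .nil)]) W H →
      TreeDraw (plug s .nil) W H := by
    rintro s b ⟨ds, h1, -, h3, h4, -, -, h7⟩
    rw [List.map_eq_append_iff] at h1
    obtain ⟨ds, ds', rfl, rfl, h2⟩ := h1
    rw [List.map_eq_singleton_iff] at h2
    obtain ⟨⟨c, v, d⟩, rfl, h2⟩ := h2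
    simp only [shapeF, relabelF, Prod.mk.injEq] at h2
    have hd : d = .nil := by
      cases d with
      | nil => rfl
      | node v l r => simp [relabel] at h2
    subst hd
    have e : plug (ds ++ [(c, v, .nil)]) .nil = plug ds (leaf v) := by
      rw [plug_append]; cases c <;> rfl
    rw [e] at h3 h4 h7
    refine ⟨plug ds .nil, shape_plug ds .nil, fun a ha => h3 a (body_plug_nil_subset _ _ ha),
      fun v hv => ?_, fun p hp => good_plug_nil (h7 p hp)⟩
    cases ds with
    | nil => simp at hv
    | cons f ds => exact h4 v (by simpa using hv)
  rcases h with h | h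
  · exact key s b h
  · have := (key (s.map mirrorF) (!b) (by simpa [mirrorF_mk, mirror] using h)).mirror
    rwa [mirror_plug, map_mirrorF_map_mirrorF] at this

/-! ### Decomposing a spine into groups -/

/-- Vertices are collected greedily until the total reaches `B`. Before each addition the total is
below `B` and the new vertex has size at most `B`, which gives `2 * B - 1`. The run also stops
before a larger vertex and before the last one, so that `s` is nonempty. -/
theorem exists_group {F : Type} (sz : F → ℕ) {B : ℕ} (rest acc : List F) (hacc : acc ≠ [])
    (hrest : rest ≠ []) (hsmall : ∀ x ∈ acc, sz x ≤ B) (hsum : (acc.map sz).sum ≤ 2 * B - 1) :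
    ∃ u s, u ≠ [] ∧ s ≠ [] ∧ acc ++ rest = u ++ s ∧ (∀ x ∈ u, sz x ≤ B) ∧
      (u.map sz).sum ≤ 2 * B - 1 ∧
      (B ≤ (u.map sz).sum ∨ (∃ z r, s = z :: r ∧ B < sz z) ∨ ∃ z, s = [z] ∧ sz z ≤ B) := by
  induction rest generalizing acc with
  | nil => exact absurd rfl hrest
  | cons z rest ih =>
    by_cases h1 : B ≤ (acc.map sz).sum
    · exact ⟨acc, z :: rest, hacc, by simp, rfl, hsmall, hsum, Or.inl h1⟩
    by_cases h2 : B < sz z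
    · exact ⟨acc, z :: rest, hacc, by simp, rfl, hsmall, hsum, Or.inr (Or.inl ⟨z, rest, rfl, h2⟩)⟩
    by_cases h3 : rest = []
    · subst h3
      exact ⟨acc, [z], hacc, by simp, rfl, hsmall, hsum, Or.inr (Or.inr ⟨z, rfl, by omega⟩)⟩
    obtain ⟨u, s, h⟩ := ih (acc ++ [z]) (by simp) h3
      (by
        intro x hx
        rcases List.mem_append.1 hx with hx | hx
        · exact hsmall x hx
        · simp at hx; subst hx; omega)
      (by simp; omega)
    exact ⟨u, s, by simpa using h⟩

/-- The weight of a spine vertex in the bound for the height. -/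
def weight {F : Type} (g sz : F → ℕ) (B a : ℕ) (x : F) : ℕ :=
  if sz x ≤ B then 3 * a * sz x else B * (g x + 3 * a)

theorem weight_small {F : Type} {g sz : F → ℕ} {B a : ℕ} {x : F} (h : sz x ≤ B) :
    weight g sz B a x = 3 * a * sz x := if_pos h

theorem weight_big {F : Type} {g sz : F → ℕ} {B a : ℕ} {x : F} (h : B < sz x) :
    weight g sz B a x = B * g x + 3 * (a * B) := by
  rw [weight, if_neg (by omega)]; ring

theorem sum_weight_small {F : Type} {g sz : F → ℕ} {B a : ℕ} {u : List F}
    (h : ∀ x ∈ u, sz x ≤ B) :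
    (u.map (weight g sz B a)).sum = 3 * a * (u.map sz).sum := by
  induction u with
  | nil => simp
  | cons x u ih =>
    rw [List.map_cons, List.sum_cons, List.map_cons, List.sum_cons, ih fun y hy => h y (by simp [hy]),
      weight_small (h x (by simp))]
    ring

/-- The height of a spine assembled from single vertices, pairs of vertices, and groups: `X s H`
means that `s` fits into height `H`, `U u c` that `u` can be crossed in height `c`. -/
theorem exists_height {F : Type} (Q : F → Prop) (X U : List F → ℕ → Prop) (g sz : F → ℕ) (B a : ℕ)
    (hB : 1 ≤ B) (ha : 5 ≤ a)
    (h1 : ∀ y, Q y → X [y] (g y + 1))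
    (h2 : ∀ x y, Q x → Q y → X [x, y] (g x + g y + 5))
    (hX : ∀ x u s H c, Q x → U u c → X s H → X (x :: (u ++ s)) (H + g x + c + 2))
    (hU1 : ∀ y, Q y → U [y] (g y + 1))
    (hU2 : ∀ u, u ≠ [] → (∀ x ∈ u, Q x) → (u.map sz).sum ≤ 2 * B - 1 → U u a)
    (hsmall : ∀ x, Q x → sz x ≤ B → g x ≤ a) (s : List F) (hs : s ≠ []) (hQ : ∀ x ∈ s, Q x) :
    ∃ H, X s H ∧ B * H ≤ (s.map (weight g sz B a)).sum + 6 * (a * B) ∧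
      ∀ x s', s = x :: s' → B < sz x →
        B * H + 3 * (a * B) ≤ (s.map (weight g sz B a)).sum + 6 * (a * B) := by
  have haB : 5 * B ≤ a * B := Nat.mul_le_mul_right _ ha
  have hsm : ∀ x, Q x → sz x ≤ B → B * g x ≤ a * B := fun x hx h => by
    rw [Nat.mul_comm a]; exact Nat.mul_le_mul_left _ (hsmall x hx h)
  have hw : ∀ x, Q x → B * g x ≤ weight g sz B a x + a * B ∧
      (B < sz x → B * g x + 3 * (a * B) ≤ weight g sz B a x) := by
    intro x hx
    by_cases h : sz x ≤ B
    · exact ⟨(hsm x hx h).trans (Nat.le_add_left _ _), fun h' => by omega⟩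
    · rw [weight_big (by omega)]
      exact ⟨by omega, fun _ => le_rfl⟩
  -- Amortisation, with heights multiplied by `B`. A vertex `x` and a run cost `g x + a + 2`. A run
  -- of size at least `B` has weight at least `3 * (a * B)`, enough for the crossing, the gaps and a
  -- small `x`. A big vertex carries `3 * (a * B)` beyond its own height. The last clause of the
  -- claim saves this credit for a preceding run that the big vertex has cut short.
  induction hn : s.length using Nat.strong_induction_on generalizing s with
  | _ n ih =>
  subst hn
  match s, hs with
  | [y], _ =>
    obtain ⟨w1, w2⟩ := hw y (hQ y (by simp))
    refine ⟨g y + 1, h1 y (hQ y (by simp)), ?_, ?_⟩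
    · simp only [List.map_cons, List.map_nil, List.sum_cons, List.sum_nil]
      linarith
    · rintro x s' hxs hx
      obtain ⟨rfl, rfl⟩ := List.cons.inj hxs
      have := w2 hx
      simp only [List.map_cons, List.map_nil, List.sum_cons, List.sum_nil]
      linarith
  | [y, z], _ =>
    obtain ⟨w1, w2⟩ := hw y (hQ y (by simp))
    obtain ⟨w3, -⟩ := hw z (hQ z (by simp))
    refine ⟨g y + g z + 5, h2 y z (hQ y (by simp)) (hQ z (by simp)), ?_, ?_⟩
    · simp only [List.map_cons, List.map_nil, List.sum_cons, List.sum_nil]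
      linarith
    · rintro x s' hxs hx
      obtain ⟨rfl, rfl⟩ := List.cons.inj hxs
      have := w2 hx
      simp only [List.map_cons, List.map_nil, List.sum_cons, List.sum_nil]
      linarith
  | x :: y :: z :: rest, _ =>
    have hQx := hQ x (by simp)
    have hQy := hQ y (by simp)
    obtain ⟨w1, w2⟩ := hw x hQx
    by_cases hy : B < sz y
    · have w3 := (hw y hQy).2 hy
      obtain ⟨H, i1, i2, -⟩ := ih (z :: rest).length (by simp) (z :: rest) (by simp)
        (fun x hx => hQ x (by simp at hx ⊢; tauto)) rfl
      refine ⟨H + g x + (g y + 1) + 2, hX x [y] (z :: rest) H _ hQx (hU1 y hQy) i1, ?_, ?_⟩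
      · simp only [List.map_cons, List.sum_cons] at i2 ⊢
        linarith
      · rintro x s' hxs hx
        obtain ⟨rfl, rfl⟩ := List.cons.inj hxs
        have := w2 hx
        simp only [List.map_cons, List.sum_cons] at i2 ⊢
        linarith
    · obtain ⟨u, s', u1, u2, u3, u4, u5, u6⟩ := exists_group sz (B := B) (z :: rest) [y] (by simp)
        (by simp) (by simpa using hy) (by simp; omega)
      rw [List.singleton_append] at u3
      have hQ' : ∀ x ∈ u ++ s', Q x := by
        intro x hx
        rw [← u3] at hx
        exact hQ x (List.mem_cons_of_mem _ hx)
      have hlen : s'.length < (x :: y :: z :: rest).length := by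
        have := congrArg List.length u3
        simp at this ⊢; omega
      obtain ⟨H, i1, i2, i3⟩ := ih s'.length hlen s' u2
        (fun x hx => hQ' x (List.mem_append_right _ hx)) rfl
      have hXH := hX x u s' H a hQx
        (hU2 u u1 (fun x hx => hQ' x (List.mem_append_left _ hx)) u5) i1
      have hsum : ((x :: y :: z :: rest).map (weight g sz B a)).sum =
          weight g sz B a x + (3 * a * (u.map sz).sum + (s'.map (weight g sz B a)).sum) := by
        rw [u3, List.map_cons, List.sum_cons, List.map_append, List.sum_append,
          sum_weight_small u4]
      rw [hsum]
      rcases u6 with u6 | ⟨z', r, rfl, hz'⟩ | ⟨z', rfl, hz'⟩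
      · have e1 : 3 * (a * B) ≤ 3 * a * (u.map sz).sum := by
          rw [Nat.mul_assoc]; exact Nat.mul_le_mul_left _ (Nat.mul_le_mul_left _ u6)
        refine ⟨_, u3 ▸ hXH, ?_, ?_⟩
        · by_cases hx : sz x ≤ B
          · have := hsm x hQx hx
            linarith [Nat.zero_le (weight g sz B a x)]
          · have := w2 (by omega)
            linarith
        · rintro x' s'' hxs hx
          obtain ⟨rfl, rfl⟩ := List.cons.inj hxs
          have := w2 hx
          linarith
      · have i4 := i3 z' r rfl hz'
        have e1 : 0 ≤ 3 * a * (u.map sz).sum := Nat.zero_le _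
        refine ⟨_, u3 ▸ hXH, ?_, ?_⟩
        · linarith
        · rintro x' s'' hxs hx
          obtain ⟨rfl, rfl⟩ := List.cons.inj hxs
          have := w2 hx
          linarith
      -- The run is cut short by the end of the spine. This happens once and is paid for by the
      -- additive `6 * (a * B)`.
      · have hQz := hQ' z' (by simp)
        have e2 := hsm z' hQz hz'
        have e1 : 0 ≤ 3 * a * (u.map sz).sum := Nat.zero_le _
        have e3 : 0 ≤ ([z'].map (weight g sz B a)).sum := Nat.zero_le _
        have hXz := hX x u [z'] _ a hQx
          (hU2 u u1 (fun x hx => hQ' x (List.mem_append_left _ hx)) u5) (h1 z' hQz)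
        refine ⟨_, u3 ▸ hXz, ?_, ?_⟩
        · linarith
        · rintro x' s'' hxs hx
          obtain ⟨rfl, rfl⟩ := List.cons.inj hxs
          have := w2 hx
          linarith

/-! ### Heavy paths -/

/-- The spine that follows the larger subtree everywhere. -/
def heavySpine : BinaryTree Unit → List (Frame Unit)
  | .nil => []
  | .node _ l r =>
    if l.numNodes ≤ r.numNodes then (false, (), l) :: heavySpine r else (true, (), r) :: heavySpine l

/-- The number of vertices of a frame. -/
def frameSize (x : Frame Unit) : ℕ := x.2.2.numNodes + 1

theorem plug_heavySpine (t : BinaryTree Unit) : plug (heavySpine t) .nil = t := by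
  induction t with
  | nil => rfl
  | node v l r hl hr =>
    rw [heavySpine]
    split_ifs
    · simp [hr, join]
    · simp [hl, join]

theorem heavySpine_ne_nil {t : BinaryTree Unit} (h : t ≠ .nil) : heavySpine t ≠ [] := by
  cases t with
  | nil => exact absurd rfl h
  | node v l r => rw [heavySpine]; split_ifs <;> simp

theorem sum_frameSize_heavySpine (t : BinaryTree Unit) :
    ((heavySpine t).map frameSize).sum = t.numNodes := by
  induction t with
  | nil => rfl
  | node v l r hl hr =>
    rw [heavySpine]
    split_ifs <;> simp [hl, hr, frameSize, BinaryTree.numNodes] <;> omega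

theorem two_mul_numNodes_lt_of_mem_heavySpine {t : BinaryTree Unit} {x : Frame Unit}
    (hx : x ∈ heavySpine t) : 2 * x.2.2.numNodes < t.numNodes := by
  induction t with
  | nil => simp [heavySpine] at hx
  | node v l r hl hr =>
    rw [heavySpine] at hx
    simp only [BinaryTree.numNodes]
    split_ifs at hx with h <;> rcases List.mem_cons.1 hx with rfl | hx
    · simp only; omega
    · have := hr hx; omega
    · simp only; omega
    · have := hl hx; omega

/-- The surplus `9 * (a * B)` lets the recursion close: `exists_height` spends `6 * (a * B)`, and
the remaining `3 * (a * B)` is what the hypothesis asks of the subtrees. The surplus survives along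
the path because a hanging subtree with at least `B` vertices faces a heavy part at least as large,
which already has it. If both parts are below `B`, the weight is only `3 * a` per vertex, and the
surplus comes from 12 - 3 = 9. -/
theorem sum_weight_heavySpine {g : Frame Unit → ℕ} {B a : ℕ} (t : BinaryTree Unit)
    (hg : ∀ x ∈ heavySpine t, B ≤ x.2.2.numNodes →
      B * g x + 3 * (a * B) ≤ 12 * (a * x.2.2.numNodes)) :
    ((heavySpine t).map (weight g frameSize B a)).sum ≤ 12 * (a * t.numNodes) ∧
      (B ≤ t.numNodes → ((heavySpine t).map (weight g frameSize B a)).sum + 9 * (a * B) ≤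
        12 * (a * t.numNodes)) := by
  have key : ∀ (b : Bool) (u s : BinaryTree Unit), u.numNodes ≤ s.numNodes →
      (∀ x ∈ (b, (), u) :: heavySpine s, B ≤ x.2.2.numNodes →
        B * g x + 3 * (a * B) ≤ 12 * (a * x.2.2.numNodes)) →
      (((heavySpine s).map (weight g frameSize B a)).sum ≤ 12 * (a * s.numNodes) ∧
        (B ≤ s.numNodes → ((heavySpine s).map (weight g frameSize B a)).sum + 9 * (a * B) ≤
        12 * (a * s.numNodes))) →
      ((((b, (), u) :: heavySpine s).map (weight g frameSize B a)).sum ≤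
          12 * (a * (u.numNodes + s.numNodes + 1)) ∧
        (B ≤ u.numNodes + s.numNodes + 1 →
          (((b, (), u) :: heavySpine s).map (weight g frameSize B a)).sum + 9 * (a * B) ≤
            12 * (a * (u.numNodes + s.numNodes + 1)))) := by
    intro b u s hus hg' ⟨ih1, ih2⟩
    by_cases hu : B ≤ u.numNodes
    · have h1 := hg' (b, (), u) (by simp) hu
      have h2 := ih2 (hu.trans hus)
      have h3 : weight g frameSize B a (b, (), u) = B * g (b, (), u) + 3 * (a * B) :=
        weight_big (by simp [frameSize]; omega)
      rw [List.map_cons, List.sum_cons, h3]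
      simp only at h1
      have h4 : 0 ≤ a := Nat.zero_le _
      constructor
      · linarith
      · intro; linarith
    · have h3 : weight g frameSize B a (b, (), u) = 3 * a * (u.numNodes + 1) :=
        weight_small (by simp [frameSize]; omega)
      have h5 : 0 ≤ a * u.numNodes := Nat.zero_le _
      have h6 : 0 ≤ a * s.numNodes := Nat.zero_le _
      refine ⟨by rw [List.map_cons, List.sum_cons, h3]; linarith, fun hB => ?_⟩
      by_cases hs : B ≤ s.numNodes
      · have h2 := ih2 hs
        rw [List.map_cons, List.sum_cons, h3]
        linarith
      · have hsum : (((b, (), u) :: heavySpine s).map frameSize).sum =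
            u.numNodes + s.numNodes + 1 := by
          rw [List.map_cons, List.sum_cons, sum_frameSize_heavySpine, frameSize]
          show u.numNodes + 1 + s.numNodes = _
          omega
        rw [sum_weight_small, hsum]
        · have := Nat.mul_le_mul_left a hB
          linarith
        · intro x hx
          rw [frameSize]
          rcases List.mem_cons.1 hx with rfl | hx
          · simp only; omega
          · have := two_mul_numNodes_lt_of_mem_heavySpine hx; omega
  induction t with
  | nil =>
    refine ⟨by simp [heavySpine], fun h => ?_⟩
    have : B = 0 := by simpa [BinaryTree.numNodes] using h
    simp [heavySpine, this]
  | node v l r hl hr =>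
    have e : (BinaryTree.node v l r).numNodes = l.numNodes + r.numNodes + 1 := rfl
    rw [e]
    rw [heavySpine] at hg ⊢
    split_ifs at hg ⊢ with h
    · exact key false l r h hg (hr fun x hx => hg x (List.mem_cons_of_mem _ hx))
    · rw [Nat.add_comm l.numNodes]
      exact key true r l (by omega) hg (hl fun x hx => hg x (List.mem_cons_of_mem _ hx))

/-! ### Drawing all trees of bounded size -/

/-- All trees and spines with at most `N` vertices have drawings of width `w` and height `h`. -/
structure DrawableUpTo (N w h : ℕ) : Prop where
  spine : ∀ s : List (Frame Unit), s ≠ [] → (s.map frameSize).sum ≤ N → SpineDraw' s w h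
  tree : ∀ t : BinaryTree Unit, t.numNodes ≤ N → TreeDraw t w h

/-- Subtrees off the heavy path have less than half of the vertices, so each level of the recursion
lowers `k` by one and adds 2 to the width. The term `3 * ((w + 6) * B)` is the credit that `weight`
grants to big vertices. -/
theorem DrawableUpTo.exists_treeDraw {B w h : ℕ} (L : DrawableUpTo (2 * B - 1) w h) (hB : 1 ≤ B)
    (k : ℕ) (t : BinaryTree Unit) (ht : t.numNodes < 2 ^ k) :
    ∃ H : ℕ, TreeDraw t (2 * h + 2 + 2 * k : ℕ) H ∧ (t.numNodes < B → H ≤ w + 6) ∧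
      (B ≤ t.numNodes → B * H + 3 * ((w + 6) * B) ≤ 12 * ((w + 6) * t.numNodes)) := by
  induction k generalizing t with
  | zero =>
    have : t = .nil := by
      cases t with
      | nil => rfl
      | node v l r => simp [BinaryTree.numNodes] at ht
    subst this
    exact ⟨0, treeDraw_nil _ _, by simp, fun h => by simp [BinaryTree.numNodes] at h; omega⟩
  | succ k ih =>
    by_cases htB : t.numNodes < B
    -- A small tree must not cost height `h`. Turning the known drawings of its two subtrees makes
    -- it lie on its side, with height `w + 1`.
    · refine ⟨w + 1, ?_, by omega, by omega⟩
      cases t with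
      | nil => exact treeDraw_nil _ _
      | node v l r =>
        simp only [BinaryTree.numNodes] at htB
        have := treeDraw_rotated (by omega) (by omega) (L.tree l (by omega)) (L.tree r (by omega))
        exact this.mono (by push_cast; omega) (by push_cast; omega)
    have hex : ∀ x : Frame Unit, ∃ H : ℕ, x.2.2.numNodes < 2 ^ k →
        TreeDraw x.2.2 (2 * h + 2 + 2 * k : ℕ) H ∧ (x.2.2.numNodes < B → H ≤ w + 6) ∧
        (B ≤ x.2.2.numNodes → B * H + 3 * ((w + 6) * B) ≤ 12 * ((w + 6) * x.2.2.numNodes)) := by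
      intro x
      by_cases hx : x.2.2.numNodes < 2 ^ k
      · obtain ⟨H, hH⟩ := ih x.2.2 hx
        exact ⟨H, fun _ => hH⟩
      · exact ⟨0, fun h => absurd h hx⟩
    choose g hg using hex
    have hQ : ∀ x ∈ heavySpine t, x.2.2.numNodes < 2 ^ k := by
      intro x hx
      have := two_mul_numNodes_lt_of_mem_heavySpine hx
      rw [pow_succ] at ht
      omega
    -- A tree needs nothing attached after its last path vertex, so a final pair is drawn with an
    -- auxiliary vertex `e` below it, deleted at the end. Using `spineDraw'_pair` here would double
    -- the width at every level.
    obtain ⟨H, ⟨e, he, hX⟩, hH, -⟩ := exists_height (fun x : Frame Unit => x.2.2.numNodes < 2 ^ k)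
      (fun s H => ∃ e : List (Frame Unit), (e = [] ∨ e = [(true, (), .nil)]) ∧
        SpineDraw' (s ++ e) (2 * h + 2 + 2 * (k + 1)) H)
      (fun u c => SpineDraw' u c (2 * h + 2 + 2 * k + 1)) g frameSize B (w + 6) hB (by omega)
      (fun y hy => ⟨[], Or.inl rfl,
        (spineDraw'_singleton (hg y hy).1).mono (by omega) le_rfl⟩)
      (fun x y hx hy => ⟨_, Or.inr rfl, by
        have hd : SpineDraw' [(true, (), .nil)] (2 * h + 2 + 2 * (k + 1)) 1 :=
          (spineDraw'_singleton (w := 0) (h := 0) (treeDraw_nil _ _)).mono (by omega) le_rfl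
        exact (SpineDraw'.append (hg x hx).1 (spineDraw'_singleton_rotated (hg y hy).1) hd
          (by omega) (by omega)).mono le_rfl (by omega)⟩)
      (fun x u s H c hx hu hs => by
        obtain ⟨e, he, hs⟩ := hs
        refine ⟨e, he, ?_⟩
        have := SpineDraw'.append (hg x hx).1 hu hs (by omega) (by omega)
        simpa using this)
      (fun y hy => spineDraw'_singleton_rotated (hg y hy).1)
      (fun u hu _ hsum => (L.spine u hu hsum).mono (by omega) (by omega))
      (fun x hx hsz => (hg x hx).2.1 (by rw [frameSize] at hsz; omega))
      (heavySpine t) (heavySpine_ne_nil (by rintro rfl; simp [BinaryTree.numNodes] at htB; omega))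
      hQ
    refine ⟨H, ?_, by omega, fun hBt => ?_⟩
    · rw [← plug_heavySpine t]
      rcases he with rfl | rfl
      · rw [List.append_nil] at hX
        exact SpineDraw.treeDraw hX
      · exact hX.treeDraw_of_append
    · have := (sum_weight_heavySpine (g := g) (B := B) (a := w + 6) t
        fun x hx hxB => (hg x (hQ x hx)).2.2 hxB).2 hBt
      linarith

theorem numNodes_lt_of_mem {s : List (Frame Unit)} {x : Frame Unit} (hx : x ∈ s) :
    x.2.2.numNodes < (s.map frameSize).sum := by
  have : frameSize x ≤ (s.map frameSize).sum := List.single_le_sum (by simp) _ (List.mem_map_of_mem hx)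
  rw [frameSize] at this
  omega

/-- Drawings of all trees of size less than `2 * B` yield drawings of larger trees. -/
theorem DrawableUpTo.extend {B w h N K : ℕ} (L : DrawableUpTo (2 * B - 1) w h) (hB : 1 ≤ B)
    (hN : N < 2 ^ K) :
    DrawableUpTo N (2 * (2 * h + 2 + 2 * K) + 4) (24 * (w + 6) * N / B + 12 * (w + 6)) := by
  have hdiv : ∀ H : ℕ, B * H ≤ 24 * ((w + 6) * N) + 12 * ((w + 6) * B) →
      H ≤ 24 * (w + 6) * N / B + 12 * (w + 6) := by
    intro H hH
    rw [← Nat.add_mul_div_left _ _ (by omega : 0 < B), Nat.le_div_iff_mul_le (by omega)]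
    linarith
  constructor
  · intro s hs hsN
    have hex : ∀ x : Frame Unit, ∃ H : ℕ, x.2.2.numNodes < 2 ^ K →
        TreeDraw x.2.2 (2 * h + 2 + 2 * K : ℕ) H ∧ (x.2.2.numNodes < B → H ≤ w + 6) ∧
        (B ≤ x.2.2.numNodes → B * H + 3 * ((w + 6) * B) ≤ 12 * ((w + 6) * x.2.2.numNodes)) := by
      intro x
      by_cases hx : x.2.2.numNodes < 2 ^ K
      · obtain ⟨H, hH⟩ := L.exists_treeDraw hB K x.2.2 hx
        exact ⟨H, fun _ => hH⟩
      · exact ⟨0, fun h => absurd h hx⟩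
    choose g hg using hex
    have hQ : ∀ x ∈ s, x.2.2.numNodes < 2 ^ K := fun x hx =>
      (numNodes_lt_of_mem hx).trans_le (hsN.trans hN.le)
    -- A spine must end on the lower side, so pairs are closed by `spineDraw'_pair`. Its factor 2 in
    -- the width occurs only once, and its factor 2 in the height is absorbed by passing to `2 * g
    -- x` and `2 * (w + 6)`.
    obtain ⟨H, hX, hH, -⟩ := exists_height (fun x : Frame Unit => x.2.2.numNodes < 2 ^ K)
      (fun s H => SpineDraw' s (2 * (2 * h + 2 + 2 * K) + 4) H)
      (fun u c => SpineDraw' u c (2 * (2 * h + 2 + 2 * K) + 3)) (fun x => 2 * g x) frameSize B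
      (2 * (w + 6)) hB (by omega)
      (fun y hy => (spineDraw'_singleton (hg y hy).1).mono (by omega) (by omega))
      (fun x y hx hy => (spineDraw'_pair (hg x hx).1 (hg y hy).1).mono (by omega) (by omega))
      (fun x u s H c hx hu hs =>
        (SpineDraw'.append (hg x hx).1 hu hs (by omega) (by omega)).mono le_rfl (by omega))
      (fun y hy => (spineDraw'_singleton_rotated (hg y hy).1).mono (by omega) (by omega))
      (fun u hu _ hsum => (L.spine u hu hsum).mono (by omega) (by omega))
      (fun x hx hsz => by
        have := (hg x hx).2.1 (by rw [frameSize] at hsz; omega)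
        omega)
      s hs hQ
    refine hX.mono le_rfl (hdiv H ?_)
    have hsum : ∀ s : List (Frame Unit), (∀ x ∈ s, x.2.2.numNodes < 2 ^ K) →
        (s.map (weight (fun x => 2 * g x) frameSize B (2 * (w + 6)))).sum ≤
        24 * ((w + 6) * (s.map frameSize).sum) := by
      intro s hs
      induction s with
      | nil => simp
      | cons x s ih =>
        have h1 := ih fun y hy => hs y (List.mem_cons_of_mem _ hy)
        have h2 := hg x (hs x (by simp))
        rw [List.map_cons, List.sum_cons, List.map_cons, List.sum_cons]
        have h3 : weight (fun x => 2 * g x) frameSize B (2 * (w + 6)) x ≤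
            24 * ((w + 6) * frameSize x) := by
          by_cases hx : frameSize x ≤ B
          · rw [weight_small hx]
            have : 0 ≤ (w + 6) * frameSize x := Nat.zero_le _
            linarith
          · rw [weight_big (by omega)]
            have h4 := h2.2.2 (by rw [frameSize] at hx; omega)
            have h5 : (w + 6) * x.2.2.numNodes ≤ (w + 6) * frameSize x :=
              Nat.mul_le_mul_left _ (by rw [frameSize]; omega)
            linarith
        linarith
    have h1 := hsum s hQ
    have h2 := Nat.mul_le_mul_left (w + 6) hsN
    linarith
  · intro t ht
    obtain ⟨H, h1, h2, h3⟩ := L.exists_treeDraw hB K t (by omega)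
    suffices hH : B * H ≤ 24 * ((w + 6) * N) + 12 * ((w + 6) * B) from
      h1.mono (by push_cast; omega) (by exact_mod_cast hdiv H hH)
    have h6 : 0 ≤ (w + 6) * N := Nat.zero_le _
    have h7 : 0 ≤ (w + 6) * B := Nat.zero_le _
    by_cases htB : t.numNodes < B
    · have := Nat.mul_le_mul_left B (h2 htB)
      linarith
    · have h4 := h3 (by omega)
      have h5 := Nat.mul_le_mul_left (w + 6) ht
      linarith

theorem drawableUpTo_one : DrawableUpTo 1 1 1 := by
  constructor
  · intro s hs hsum
    cases s with
    | nil => exact absurd rfl hs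
    | cons x s =>
      have hx := numNodes_lt_of_mem (List.mem_cons_self (a := x) (l := s))
      rw [List.map_cons, List.sum_cons, frameSize] at hsum
      have hs : s = [] := by
        cases s with
        | nil => rfl
        | cons y s => rw [List.map_cons, List.sum_cons, frameSize] at hsum; omega
      subst hs
      have : x.2.2 = .nil := by
        cases h : x.2.2 with
        | nil => rfl
        | node v l r => rw [h] at hsum; simp [BinaryTree.numNodes] at hsum
      exact spineDraw'_singleton (w := 0) (h := 0) (this ▸ treeDraw_nil _ _)
  · intro t ht
    cases t with
    | nil => exact treeDraw_nil _ _
    | node v l r =>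
      have hl : l = .nil := by
        cases l with
        | nil => rfl
        | node => simp [BinaryTree.numNodes] at ht
      have hr : r = .nil := by
        cases r with
        | nil => rfl
        | node => simp [BinaryTree.numNodes] at ht
      subst hl hr
      exact SpineDraw.treeDraw (s := [(true, (), .nil)])
        (spineDraw'_singleton (w := 0) (h := 0) (treeDraw_nil _ _))

/-! ### Iterating the construction -/

/-- Trees with at most `N` vertices fit in width `O(log N)` and height `O(N / log N)`, with
constant `κ`. -/
def Efficient (κ N : ℕ) : Prop :=
  ∃ w h, DrawableUpTo N w h ∧ w ≤ κ * N.size ∧ h * N.size ≤ κ * N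

theorem Efficient.mono {κ κ' N : ℕ} (h : Efficient κ N) (hκ : κ ≤ κ') : Efficient κ' N := by
  obtain ⟨a, b, h1, h2, h3⟩ := h
  exact ⟨a, b, h1, h2.trans (Nat.mul_le_mul_right _ hκ), h3.trans (Nat.mul_le_mul_right _ hκ)⟩

theorem sq_le_two_mul_two_pow (m : ℕ) : m ^ 2 ≤ 2 * 2 ^ m := by
  induction m with
  | zero => norm_num
  | succ m ih =>
    rcases Nat.lt_or_ge m 3 with h | h
    · interval_cases m <;> norm_num
    · rw [pow_succ 2 m]
      nlinarith

theorem two_pow_size_le {n : ℕ} (hn : 1 ≤ n) : 2 ^ n.size ≤ 2 * n := by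
  have h : 0 < n.size := Nat.size_pos.2 hn
  have h1 : 2 ^ (n.size - 1) ≤ n := Nat.lt_size.1 (by omega)
  obtain ⟨k, hk⟩ : ∃ k, n.size = k + 1 := ⟨n.size - 1, by omega⟩
  rw [hk] at h1 ⊢
  rw [pow_succ]
  simp only [Nat.add_sub_cancel] at h1
  omega

theorem size_le_self (n : ℕ) : n.size ≤ n := Nat.size_le.2 Nat.lt_two_pow_self

/-- The size of the trees on which the construction for trees of size `N` relies. -/
def reduced (N : ℕ) : ℕ := 2 * (N.size * N.size.size) - 1

theorem size_size_pos {N : ℕ} (hN : 1 ≤ N) : 1 ≤ N.size.size :=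
  Nat.size_pos.2 (Nat.size_pos.2 hN)

theorem size_le_reduced {N : ℕ} (hN : 1 ≤ N) : N.size ≤ reduced N := by
  have h1 : 0 < N.size := Nat.size_pos.2 hN
  have h2 := Nat.mul_le_mul_left N.size (size_size_pos hN)
  rw [reduced]
  omega

theorem size_reduced_le {N : ℕ} (hN : 1 ≤ N) : (reduced N).size ≤ 3 * N.size.size := by
  have h0 := size_size_pos hN
  suffices h : (reduced N).size ≤ 2 * N.size.size + 1 by omega
  rw [Nat.size_le]
  have h1 : N.size < 2 ^ N.size.size := Nat.lt_size_self _
  have h2 : N.size * N.size.size ≤ 2 ^ N.size.size * 2 ^ N.size.size :=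
    Nat.mul_le_mul h1.le ((size_le_self _).trans h1.le)
  have h3 : 1 ≤ 2 ^ N.size.size * 2 ^ N.size.size := Nat.mul_pos (by positivity) (by positivity)
  rw [reduced, pow_succ, two_mul N.size.size, pow_add]
  omega

/-- With B = `N.size * N.size.size`, the size of `reduced N` agrees with `N.size.size` up to a
factor 3. So `h` is O(κ log N) and `w` is O(κ log log N). The extension has width O(h + log N) and
height O(wN / B), in which log log N cancels. -/
theorem Efficient.step {κ N : ℕ} (hκ : 1 ≤ κ) (hN : 1 ≤ N) (h : Efficient κ (reduced N)) :
    Efficient (2 ^ 11 * κ) N := by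
  obtain ⟨w, h, hd, hw, hh⟩ := h
  have hm : 1 ≤ N.size := Nat.size_pos.2 hN
  have hM := size_size_pos hN
  have hB : 1 ≤ N.size * N.size.size := Nat.mul_pos hm hM
  have hle := size_reduced_le hN
  have hge : N.size.size ≤ (reduced N).size := Nat.size_le_size (size_le_reduced hN)
  have hMm := size_le_self N.size
  have hsq := sq_le_two_mul_two_pow N.size
  have hpow := two_pow_size_le hN
  refine ⟨_, _, DrawableUpTo.extend hd hB (Nat.lt_size_self N), ?_, ?_⟩
  · have h1 : h * N.size.size ≤ 2 * κ * N.size * N.size.size := by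
      have h2 := (Nat.mul_le_mul_left h hge).trans hh
      have h3 : reduced N ≤ 2 * (N.size * N.size.size) := by rw [reduced]; omega
      have h4 := Nat.mul_le_mul_left κ h3
      linarith
    have h5 : h ≤ 2 * κ * N.size := Nat.le_of_mul_le_mul_right h1 hM
    nlinarith
  · generalize N.size.size = M at *
    generalize N.size = m at *
    have ha : w + 6 ≤ 9 * κ * M := by
      have h2 := Nat.mul_le_mul_left κ hle
      have h3 : 1 ≤ κ * M := Nat.mul_pos hκ hM
      linarith
    have hq : 24 * (w + 6) * N / (m * M) * m ≤ 216 * κ * N := by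
      refine Nat.le_of_mul_le_mul_right (c := M) ?_ hM
      have h2 := Nat.div_mul_le_self (24 * (w + 6) * N) (m * M)
      have h3 := Nat.mul_le_mul_right N ha
      linarith
    -- The additive term of the height is negligible because `M * m ≤ m ^ 2 ≤ 2 * 2 ^ m ≤ 4 * N`.
    have hr : (w + 6) * m ≤ 36 * κ * N := by
      have h2 := Nat.mul_le_mul_right m ha
      have h3 : M * m ≤ 4 * N := by nlinarith
      have h4 := Nat.mul_le_mul_left (9 * κ) h3
      linarith
    have hp : 0 ≤ κ * N := Nat.zero_le _
    linarith

/-- Here log N is bounded by `2 ^ 13`, and one extension with B = 1 suffices: its height is at most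
252 · N, and 252 · 2^13 ≤ 2^21. -/
theorem efficient_of_size_size_lt {N : ℕ} (hN : 1 ≤ N) (h : N.size.size < 13) :
    Efficient (2 ^ 21) N := by
  have hm : 1 ≤ N.size := Nat.size_pos.2 hN
  have hm' : N.size < 2 ^ 13 :=
    (Nat.lt_size_self _).trans (Nat.pow_lt_pow_right (by norm_num) h)
  refine ⟨_, _, DrawableUpTo.extend (B := 1) drawableUpTo_one le_rfl (Nat.lt_size_self N), ?_, ?_⟩
  · omega
  · rw [Nat.div_one]
    have h1 := Nat.mul_le_mul_left N hm'.le
    nlinarith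

theorem two_mul_sq_lt_two_pow {M : ℕ} (h : 13 ≤ M) : 2 * (18 * M ^ 2 + 1) ≤ 2 ^ M := by
  induction M, h using Nat.le_induction with
  | base => norm_num
  | succ M h ih => rw [pow_succ 2 M]; nlinarith

theorem reduced_pos {N : ℕ} (hN : 1 ≤ N) : 1 ≤ reduced N :=
  (Nat.size_pos.2 hN).trans_le (size_le_reduced hN)

/-- With M = `N.size.size`, the size of `reduced N` is at most 3M, so the second reduction gives at
most 18M². From M = 13 on, this is less than 2^(M-1), which is at most `N.size`. -/
theorem reduced_reduced_lt_size {N : ℕ} (hN : 1 ≤ N) (h : 13 ≤ N.size.size) :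
    reduced (reduced N) < N.size := by
  have h1 := size_reduced_le hN
  have h2 := size_le_self (reduced N).size
  have h3 := two_pow_size_le (n := N.size) (Nat.size_pos.2 hN)
  have h4 := two_mul_sq_lt_two_pow h
  have h5 : (reduced N).size * (reduced N).size.size ≤ 3 * N.size.size * (3 * N.size.size) :=
    Nat.mul_le_mul h1 (h2.trans h1)
  have h6 : reduced (reduced N) ≤ 2 * ((reduced N).size * (reduced N).size.size) := by
    rw [reduced]; omega
  nlinarith

/-- `Real.logb` is monotone only on positive arguments, so iterates of `x` and `y` cannot be
compared once that of `x` has fallen to 1 or below. The iteration is stopped there, which is why `i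
≤ k` replaces `k`. -/
theorem iterate_logb_le_one {k : ℕ} {x y : ℝ} (hxy : x ≤ y) (h : (Real.logb 2)^[k] y ≤ 1) :
    ∃ i ≤ k, (Real.logb 2)^[i] x ≤ 1 := by
  induction k generalizing x y with
  | zero => exact ⟨0, le_rfl, hxy.trans h⟩
  | succ k ih =>
    by_cases hx : x ≤ 1
    · exact ⟨0, Nat.zero_le _, hx⟩
    · have hx0 : 0 < x := by linarith
      obtain ⟨i, hi, hi'⟩ := ih (Real.logb_le_logb_of_le (by norm_num) hx0 hxy) h
      exact ⟨i + 1, by omega, hi'⟩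

theorem iterate_logb_logStar (x : ℝ) : (Real.logb 2)^[logStar x] x ≤ 1 :=
  Nat.sInf_mem (logStar_set_nonempty x)

theorem logStar_pos {x : ℝ} (hx : 1 < x) : 0 < logStar x := by
  by_contra h
  have h1 := iterate_logb_logStar x
  rw [show logStar x = 0 by omega] at h1
  exact absurd h1 (not_le.2 hx)

theorem logStar_lt_of_le_logb {x y : ℝ} (hy : 1 < y) (h : x ≤ Real.logb 2 y) :
    logStar x < logStar y := by
  have h1 := iterate_logb_logStar y
  obtain ⟨k, hk⟩ : ∃ k, logStar y = k + 1 := ⟨logStar y - 1, by have := logStar_pos hy; omega⟩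
  rw [hk] at h1 ⊢
  obtain ⟨i, hi, hi'⟩ := iterate_logb_le_one h h1
  exact Nat.lt_succ_of_le ((Nat.sInf_le hi').trans hi)

theorem logStar_reduced_reduced_lt {N : ℕ} (hN : 1 ≤ N) (h : 13 ≤ N.size.size) :
    logStar (reduced (reduced N) : ℕ) < logStar N := by
  have h1 := reduced_reduced_lt_size hN h
  have h2 : 2 ^ reduced (reduced N) ≤ N := Nat.lt_size.1 h1
  have h3 := reduced_pos (reduced_pos hN)
  have h4 : 1 < N := lt_of_lt_of_le (Nat.one_lt_two_pow (by omega)) h2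
  refine logStar_lt_of_le_logb (by exact_mod_cast h4) ?_
  rw [Real.le_logb_iff_rpow_le (by norm_num) (by exact_mod_cast hN), Real.rpow_natCast]
  exact_mod_cast h2

/-- Two rounds lower log* by at least one and multiply the constant by 2^11 each, hence the exponent
22 per unit. -/
theorem efficient_logStar (j : ℕ) {N : ℕ} (hN : 1 ≤ N) (hj : logStar N ≤ j) :
    Efficient (2 ^ (21 + 22 * j)) N := by
  induction j generalizing N with
  | zero =>
    by_cases h : N.size.size < 13
    · exact efficient_of_size_size_lt hN h
    · have := logStar_reduced_reduced_lt hN (by omega)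
      omega
  | succ j ih =>
    by_cases h : N.size.size < 13
    · exact (efficient_of_size_size_lt hN h).mono (Nat.pow_le_pow_right (by norm_num) (by omega))
    · have h1 := logStar_reduced_reduced_lt hN (by omega)
      have h2 := ih (reduced_pos (reduced_pos hN)) (by omega)
      have h3 := (h2.step Nat.one_le_two_pow (reduced_pos hN)).step
        (Nat.mul_pos (by norm_num) Nat.one_le_two_pow) hN
      refine h3.mono (le_of_eq ?_)
      rw [← pow_add, ← pow_add]
      congr 1
      omega

/-! ### The main theorem -/

theorem exists_drawing_of_treeDraw {T : BinaryTree Unit} {w h : ℕ} (H : TreeDraw T w h) :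
    ∃ pos, IsPlanarDrawing T (w + 1) (h + 1) pos ∧ IsOrderPreserving T pos := by
  obtain ⟨d, rfl, hbox, -, hgood⟩ := H.left 1 1
  have hg := hgood (0, 1) (by norm_num)
  refine ⟨label d, hg.isPlanarDrawing fun a ha => ?_, hg.isOrderPreserving⟩
  obtain ⟨h1, h2, h3, h4⟩ := hbox a ha
  push_cast at h1 h2 h3 h4 ⊢
  exact ⟨h1, by linarith, h3, by linarith⟩

theorem isVertex_single {v : List Bool} (h : IsVertex (.node () .nil .nil) v) : v = [] := by
  match v with
  | [] => rfl
  | false :: _ => exact h.elim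
  | true :: _ => exact h.elim

theorem not_isEdge_single {u v : List Bool} : ¬ IsEdge (.node () .nil .nil) u v := by
  rintro ⟨h, b, rfl⟩
  exact List.append_ne_nil_of_right_ne_nil _ (List.cons_ne_nil _ _) (isVertex_single h)

theorem isPlanarDrawing_single : IsPlanarDrawing (.node () .nil .nil) 1 1 fun _ => (1, 1) where
  mem_grid _ _ := by simp
  injective _ _ hu hv _ := (isVertex_single hu).trans (isVertex_single hv).symm
  vertex_edge _ _ _ _ h := (not_isEdge_single h).elim
  edge_edge _ _ _ _ h := (not_isEdge_single h).elim

theorem eq_single {T : BinaryTree Unit} (h : T.numNodes = 1) : T = .node () .nil .nil := by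
  match T with
  | .nil => simp [BinaryTree.numNodes] at h
  | .node () (.node _ _ _) _ => simp [BinaryTree.numNodes] at h
  | .node () .nil (.node _ _ _) => simp [BinaryTree.numNodes] at h
  | .node () .nil .nil => rfl

theorem Efficient.exists_area_le {κ n : ℕ} (h : Efficient κ n) (hκ : 1 ≤ κ) (hn : 1 ≤ n) :
    ∃ w h, DrawableUpTo n w h ∧ (w + 1) * (h + 1) ≤ n * (4 * κ ^ 2) := by
  obtain ⟨w, h, hd, hw, hh⟩ := h
  refine ⟨w, h, hd, ?_⟩
  have hm : 1 ≤ n.size := Nat.size_pos.2 hn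
  have h1 : w + 1 ≤ 2 * κ * n.size := by nlinarith
  have h2 : (h + 1) * n.size ≤ 2 * κ * n := by
    have := size_le_self n
    nlinarith
  calc (w + 1) * (h + 1) ≤ 2 * κ * n.size * (h + 1) := Nat.mul_le_mul_right _ h1
    _ = 2 * κ * ((h + 1) * n.size) := by ring
    _ ≤ 2 * κ * (2 * κ * n) := Nat.mul_le_mul_left _ h2
    _ = n * (4 * κ ^ 2) := by ring

end BinaryTreeDrawing

theorem mainTheorem6 :
    ∃ C : ℝ, ∀ (n : ℕ) (T : BinaryTree Unit), 1 ≤ n → T.numNodes = n →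
      ∃ (W H : ℕ) (pos : List Bool → ℤ × ℤ),
        BinaryTreeDrawing.IsPlanarDrawing T W H pos ∧
        BinaryTreeDrawing.IsOrderPreserving T pos ∧
        ((W * H : ℕ) : ℝ) ≤ (n : ℝ) * (2 : ℝ) ^ (C * (BinaryTreeDrawing.logStar (n : ℝ) : ℝ)) := by
  -- For n = 1 the exponent vanishes and the area must be exactly 1, so this case is treated by
  -- hand. For n > 1, log* n = j is at least 1, and the factor 4 · (2^(21+22j))² = 2^(44+44j) is at
  -- most 2^(88j).
  refine ⟨88, fun n T hn hT => ?_⟩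
  obtain rfl | hn2 := hn.eq_or_lt
  · obtain rfl := BinaryTreeDrawing.eq_single hT
    refine ⟨1, 1, _, BinaryTreeDrawing.isPlanarDrawing_single,
      fun p v h => (BinaryTreeDrawing.not_isEdge_single h).elim, ?_⟩
    have := Real.one_le_rpow (x := 2) (z := 88 * (BinaryTreeDrawing.logStar ((1 : ℕ) : ℝ) : ℝ))
      (by norm_num) (by positivity)
    simpa using this
  · have hj := BinaryTreeDrawing.logStar_pos (x := n) (by exact_mod_cast hn2)
    generalize hjn : BinaryTreeDrawing.logStar (n : ℝ) = j at hj
    obtain ⟨w, h, hd, harea⟩ := (BinaryTreeDrawing.efficient_logStar j hn hjn.le).exists_area_le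
      Nat.one_le_two_pow hn
    obtain ⟨pos, h1, h2⟩ := BinaryTreeDrawing.exists_drawing_of_treeDraw (hd.tree T hT.le)
    refine ⟨_, _, pos, h1, h2, ?_⟩
    have hpow : 4 * (2 ^ (21 + 22 * j)) ^ 2 ≤ 2 ^ (88 * j) := by
      rw [← pow_mul, show 4 = 2 ^ 2 by norm_num, ← pow_add]
      exact Nat.pow_le_pow_right (by norm_num) (by omega)
    rw [show (88 : ℝ) * j = ((88 * j : ℕ) : ℝ) by push_cast; ring, Real.rpow_natCast]
    exact_mod_cast harea.trans (Nat.mul_le_mul_left n hpow)
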